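/- A constructive metric space $\mathbf X=(X,d,D,\alpha)$ is a complete separable metric space $(X,d)$ with a countable dense set $D$ and a numbering $\alpha\colon\mathbb N\to D$ (onto $D$) such that $d(\alpha(m),\alpha(n))$ is computable to any required accuracy, uniformly in $m,n$. Its basic balls are the open balls with centers in $D$ and positive rational radii. A function $f\colon X\to[0,\infty]$ is lower semicomputable if the set $\{x : f(x)>r\}$ is the union of an enumerable family of basic balls, uniformly in rational $r$. A compact set is effectively compact if the set of all its finite coverings by basic balls is enumerable. Let $\mathcal M(\mathbf X)$ be the space of Borel probability measures on $X$ with the Prokhorov metric, in which the dense set consists of the measures concentrated on finite subsets of $D$ with rational values, numbered by their natural descriptions; $X\times\mathcal M(\mathbf X)$ carries the product structure. A uniform test is a lower semicomputable function $t\colon X\times\mathcal M(\mathbf X)\to[0,\infty]$ with $\int t(x,P)\,dP(x)\le1$ for every $P\in\mathcal M(\mathbf X)$. A point $x$ is uniformly random with respect to $P$ if $t(x,P)<\infty$ for every uniform test $t$ (equivalently, for a universal one, i.e. one that is maximal up to a constant factor); $\mathrm{Randoms}(P)$ is the set of these points. A class $\mathcal C\subseteq\mathcal M(\mathbf X)$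 is effectively orthogonal if $\mathrm{Randoms}(P)\cap\mathrm{Randoms}(Q)=\varnothing$ for any two distinct $P,Q\in\mathcal C$. A separator for $\mathcal C$ is a Borel function $s\colon X\times\mathcal M(\mathbf X)\to[0,\infty]$ such that $\int s(x,P)\,dP(x)\le 1$ for every $P\in\mathcal M(\mathbf X)$, and for any two distinct $P,Q\in\mathcal C$ and any $x\in X$ at least one of $s(x,P)$, $s(x,Q)$ is infinite. **Theorem.** Let $\mathbf X$ be a constructive metric space and let $\mathcal C\subseteq\mathcal M(\mathbf X)$ be an effectively compact class of measures for which there is a separator $s(x,P)$ that is lower semicontinuous on $X\times\mathcal M(\mathbf X)$ (not necessarily lower semicomputable). Then $\mathcal C$ is effectively orthogonal. -/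

import Mathlib

open MeasureTheory
open scoped ENNReal NNReal

noncomputable section

/-! ### Rational numbers and basic balls given by codes

The code `(a, b)` stands for the rational number `a / (b + 1)`; every nonnegative rational number
has a code. Computability and enumerability on codes are Mathlib's `Computable` and `REPred`. -/

/-- The positive rational number `(a + 1) / (b + 1)`; every positive rational has this form. -/
def posRat (q : ℕ × ℕ) : ℝ := ((q.1 : ℝ) + 1) / ((q.2 : ℝ) + 1)

/-- The nonnegative rational number `a / (b + 1)`, in `[0, ∞]`. -/
def nonnegRat (q : ℕ × ℕ) : ℝ≥0∞ := (q.1 : ℝ≥0∞) / ((q.2 : ℝ≥0∞) + 1)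

/-- A constructive metric space: a complete separable metric space with a numbering
`pt : ℕ → X` of a countable dense set, for which the distance between `pt m` and `pt n` is
computable, uniformly in `m` and `n`, with any required accuracy. -/
structure ConstructiveMetricSpace (X : Type*) [MetricSpace X] where
  pt : ℕ → X
  complete : CompleteSpace X
  denseRange_pt : DenseRange pt
  computable_dist : ∃ f : ℕ × ℕ × ℕ → ℕ × ℕ, Computable f ∧
    ∀ m n k : ℕ, |dist (pt m) (pt n) -
      ((f (m, n, k)).1 : ℝ) / (((f (m, n, k)).2 : ℝ) + 1)| ≤ 2⁻¹ ^ k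

section Effective

variable {Y : Type*} [PseudoMetricSpace Y] {ι : Type} [Primcodable ι]

/-- The basic ball with code `(i, a, b)`, for a numbering `β` of a dense set: the open ball with
center `β i` and radius the positive rational number with code `(a, b)`. -/
def basicBall (β : ι → Y) (c : ι × ℕ × ℕ) : Set Y := Metric.ball (β c.1) (posRat c.2)

/-- A function `f : Y → [0, ∞]` is lower semicomputable if the sets `{y | r < f y}` are effectively
open uniformly in the rational number `r`: one enumerates, given `r`, a family of basic balls
whose union is this set. (For negative `r` the set is the whole space.) -/
def IsLowerSemicomputable (β : ι → Y) (f : Y → ℝ≥0∞) : Prop :=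
  ∃ W : (ℕ × ℕ) × (ι × ℕ × ℕ) → Prop, REPred W ∧
    ∀ r : ℕ × ℕ, {y | nonnegRat r < f y} = ⋃ (c) (_ : W (r, c)), basicBall β c

/-- A set is effectively compact if it is compact and the set of its finite coverings by
basic balls is enumerable. -/
def IsEffectivelyCompact (β : ι → Y) (C : Set Y) : Prop :=
  IsCompact C ∧ REPred fun L : List (ι × ℕ × ℕ) => C ⊆ ⋃ c ∈ L, basicBall β c

end Effective

section Measures

variable {X : Type*} [MeasurableSpace X]

/-- The space of Borel probability measures on `X`, with the Prokhorov metric. -/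
abbrev MeasureSpaceOn (X : Type*) [MeasurableSpace X] := LevyProkhorov (ProbabilityMeasure X)

/-- The unnormalized measure with a point mass `w + 1` at `α i` for every entry `(i, w)` of a
list. -/
def listMeasure (α : ℕ → X) (l : List (ℕ × ℕ)) : Measure X :=
  (l.map fun p => ((p.2 + 1 : ℕ) : ℝ≥0∞) • Measure.dirac (α p.1)).sum

theorem listMeasure_univ_ne_zero (α : ℕ → X) (p : ℕ × ℕ) (l : List (ℕ × ℕ)) :
    listMeasure α (p :: l) Set.univ ≠ 0 := by
  simp [listMeasure]

theorem listMeasure_univ_ne_top (α : ℕ → X) (l : List (ℕ × ℕ)) :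
    listMeasure α l Set.univ ≠ ∞ := by
  induction l with
  | nil => simp [listMeasure]
  | cons p l ih =>
    have h : listMeasure α (p :: l) Set.univ = (p.2 + 1 : ℕ) + listMeasure α l Set.univ := by
      simp [listMeasure]
    rw [h]
    exact ENNReal.add_ne_top.2 ⟨ENNReal.natCast_ne_top _, ih⟩

theorem isProbabilityMeasure_normalize (α : ℕ → X) (p : ℕ × ℕ) (l : List (ℕ × ℕ)) :
    IsProbabilityMeasure
      ((listMeasure α (p :: l) Set.univ)⁻¹ • listMeasure α (p :: l)) :=
  ⟨by
    rw [Measure.smul_apply, smul_eq_mul]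
    exact ENNReal.inv_mul_cancel (listMeasure_univ_ne_zero α p l) (listMeasure_univ_ne_top α _)⟩

/-- The measures concentrated on a finite subset of the dense set, with rational values, numbered
by their descriptions: a code is a nonempty list (given by its head and its tail) of pairs
`(i, w)`, and the measure has mass proportional to `w + 1` at `α i` for the entries `(i, w)`. -/
def measurePt (α : ℕ → X) (c : (ℕ × ℕ) × List (ℕ × ℕ)) : MeasureSpaceOn X :=
  LevyProkhorov.ofMeasure ⟨(listMeasure α (c.1 :: c.2) Set.univ)⁻¹ • listMeasure α (c.1 :: c.2),
    isProbabilityMeasure_normalize α c.1 c.2⟩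

variable [MetricSpace X] [BorelSpace X]

/-- The numbering of the dense set in the product `X × M(X)` with the product (maximum) metric. -/
def prodPt (α : ℕ → X) (c : ℕ × ((ℕ × ℕ) × List (ℕ × ℕ))) : X × MeasureSpaceOn X :=
  (α c.1, measurePt α c.2)

/-- The integral of `x ↦ t (x, P)` with respect to `P` is at most `1`, for all `P`. -/
def HasMeanAtMostOne (t : X × MeasureSpaceOn X → ℝ≥0∞) : Prop :=
  ∀ P : MeasureSpaceOn X, ∫⁻ x, t (x, P) ∂(P.toMeasure : Measure X) ≤ 1

/-- A uniform test of randomness. -/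
def IsUniformTest (S : ConstructiveMetricSpace X) (t : X × MeasureSpaceOn X → ℝ≥0∞) : Prop :=
  IsLowerSemicomputable (prodPt S.pt) t ∧ HasMeanAtMostOne t

/-- A uniform test that is maximal up to a constant factor. -/
def IsUniversalTest (S : ConstructiveMetricSpace X) (t : X × MeasureSpaceOn X → ℝ≥0∞) : Prop :=
  IsUniformTest S t ∧ ∀ t', IsUniformTest S t' → ∃ c : ℝ≥0, ∀ z, t' z ≤ c * t z

/-- The points that are uniformly random with respect to `P`: those at which all uniform tests are
finite. Equivalently, some (any) universal uniform test is finite, see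
`IsUniversalTest.mem_randoms_iff`. -/
def randoms (S : ConstructiveMetricSpace X) (P : MeasureSpaceOn X) : Set X :=
  {x | ∀ t, IsUniformTest S t → t (x, P) < ∞}

theorem IsUniversalTest.mem_randoms_iff {S : ConstructiveMetricSpace X}
    {u : X × MeasureSpaceOn X → ℝ≥0∞} (hu : IsUniversalTest S u) (P : MeasureSpaceOn X) (x : X) :
    x ∈ randoms S P ↔ u (x, P) < ∞ := by
  refine ⟨fun h => h u hu.1, fun h t ht => ?_⟩
  obtain ⟨c, hc⟩ := hu.2 t ht
  exact (hc (x, P)).trans_lt (ENNReal.mul_lt_top ENNReal.coe_lt_top h)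

/-- A class of measures is effectively orthogonal if no point is uniformly random with respect to
two different measures of the class. -/
def IsEffectivelyOrthogonal (S : ConstructiveMetricSpace X) (C : Set (MeasureSpaceOn X)) : Prop :=
  ∀ P ∈ C, ∀ Q ∈ C, P ≠ Q → randoms S P ∩ randoms S Q = ∅

/-- A separator for a class of measures: a Borel function `s : X × M(X) → [0, ∞]` with
`∫ s(x, P) dP(x) ≤ 1` for all measures `P`, such that for any two different measures `P`, `Q` in the
class and any point `x` at least one of the values `s(x, P)` and `s(x, Q)` is infinite. -/
def IsSeparator (C : Set (MeasureSpaceOn X)) (s : X × MeasureSpaceOn X → ℝ≥0∞) : Prop :=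
  Measurable[borel (X × MeasureSpaceOn X)] s ∧ HasMeanAtMostOne s ∧
    ∀ P ∈ C, ∀ Q ∈ C, P ≠ Q → ∀ x, s (x, P) = ∞ ∨ s (x, Q) = ∞

end Measures

end

/-! The separator is not computable, so it serves only to show that certain finite lists of balls
exist; effective compactness then lets an algorithm find such lists without knowing the separator.

Let `P ≠ Q` in `C`. Some open set distinguishes them, and shrinking it to finitely many balls gives
two effectively open sets `D₁`, `D₂` covering the space of measures, with `P ∉ D₁` and `Q ∉ D₂`
(`exists_separating_ballList`). So `K₁ = C \ D₁` and `K₂ = C \ D₂` are disjoint compact sets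
containing `P` and `Q`. For large `r` the sets of `x` with `s (x, R) > r` for all `R` in `K₁`,
respectively `K₂`, are open by compactness, cover `X` by separation, and are small for the measures
of `K₁`, respectively `K₂`, by Markov's inequality. Approximating the second from inside yields a
finite union of balls almost full for all of `K₁`, while the complement of the doubled closed balls
is almost full for all of `K₂` (`exists_ballList_of_separator`).

These two properties of a list `L` say that `C` lies in `D₁`, respectively `D₂`, together with an
effectively open set depending on `L`. This is enumerable (`IsEffectivelyOpen.measure`,
`IsEffectivelyCompact.rePred_subset`), so a computable sequence `L k` exists with rapidly shrinking
errors. It yields two uniform tests (`exists_isUniformTest_of_disjoint`). Every `x` lies infinitely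
often in one of two exceptional open sets, so one test is infinite at `(x, P)` or the other at `(x,
Q)`. -/

theorem exists_stage_forall_mem_list {β : Type*} {R : β → ℕ → Prop}
    (mR : ∀ a m n, m ≤ n → R a m → R a n)
    (l : List β) (h : ∀ b ∈ l, ∃ n, R b n) : ∃ n, ∀ b ∈ l, R b n := by
  induction l with
  | nil => exact ⟨0, by simp⟩
  | cons b l ih =>
    obtain ⟨n, hn⟩ := h b (by simp)
    obtain ⟨m, hm⟩ := ih fun b hb => h b (by simp [hb])
    refine ⟨max n m, fun c hc => ?_⟩
    rcases List.mem_cons.1 hc with rfl | hc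
    · exact mR _ _ _ (le_max_left _ _) hn
    · exact mR _ _ _ (le_max_right _ _) (hm c hc)

/-! ### Closure properties of enumerable predicates, via primitive recursive stages. -/

section RecursivelyEnumerable

variable {α β σ : Type*} [Primcodable α] [Primcodable β] [Primcodable σ]

theorem REPred.of_exists_primrecRel {R : α → ℕ → Prop} (hR : PrimrecRel R) :
    REPred fun a => ∃ n, R a n := by
  classical
  have h : Partrec fun a => Nat.rfind fun n => (Part.some (decide (R a n)) : Part Bool) :=
    Partrec.rfind (p := fun a n => Part.some (decide (R a n))) (hR.decide.to_comp.partrec)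
  refine h.dom_re.of_eq fun a => ?_
  refine Nat.rfind_dom.trans ⟨?_, ?_⟩
  · rintro ⟨n, hn, -⟩
    exact ⟨n, of_decide_eq_true (Part.mem_some_iff.1 hn).symm⟩
  · rintro ⟨n, hn⟩
    exact ⟨n, Part.mem_some_iff.2 (decide_eq_true hn).symm, fun _ => trivial⟩

/-- A recursively enumerable predicate is the monotone union of a primitive recursive sequence of
approximations. -/
theorem REPred.exists_primrecRel {p : α → Prop} (hp : REPred p) :
    ∃ R : α → ℕ → Prop, PrimrecRel R ∧ (∀ a m n, m ≤ n → R a m → R a n) ∧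
      ∀ a, p a ↔ ∃ n, R a n := by
  obtain ⟨c, hc⟩ := Nat.Partrec.Code.exists_code.1 hp
  refine ⟨fun a n => (Nat.Partrec.Code.evaln n c (Encodable.encode a)).isSome = true, ?_, ?_, ?_⟩
  · have h : Primrec fun x : α × ℕ =>
        (Nat.Partrec.Code.evaln x.2 c (Encodable.encode x.1)).isSome :=
      Primrec.option_isSome.comp (Nat.Partrec.Code.primrec_evaln.comp
        (Primrec.pair (Primrec.pair Primrec.snd (Primrec.const c))
          (Primrec.encode.comp Primrec.fst)))
    exact Primrec.eq.comp h (Primrec.const true)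
  · intro a m n hmn h
    obtain ⟨x, hx⟩ := Option.isSome_iff_exists.1 h
    exact Option.isSome_iff_exists.2 ⟨x, Nat.Partrec.Code.evaln_mono hmn hx⟩
  · intro a
    have h1 : p a ↔ (Nat.Partrec.Code.eval c (Encodable.encode a)).Dom := by
      rw [hc]
      simp [Part.assert]
    rw [h1, Part.dom_iff_mem]
    constructor
    · rintro ⟨y, hy⟩
      obtain ⟨k, hk⟩ := Nat.Partrec.Code.evaln_complete.1 hy
      exact ⟨k, Option.isSome_iff_exists.2 ⟨y, hk⟩⟩
    · rintro ⟨n, hn⟩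
      obtain ⟨y, hy⟩ := Option.isSome_iff_exists.1 hn
      exact ⟨y, Nat.Partrec.Code.evaln_sound hy⟩

theorem PrimrecPred.rePred {p : α → Prop} (hp : PrimrecPred p) : REPred p := by
  classical
  exact ComputablePred.to_re ⟨inferInstance, hp.decide.to_comp⟩

theorem REPred.comp {p : β → Prop} (hp : REPred p) {f : α → β} (hf : Computable f) :
    REPred fun a => p (f a) :=
  Partrec.comp hp hf

theorem REPred.exists {p : α × β → Prop} (hp : REPred p) : REPred fun a => ∃ b, p (a, b) := by
  obtain ⟨R, hR, -, h⟩ := hp.exists_primrecRel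
  classical
  -- The single index `n` codes both a candidate `b` and a stage.
  have key : PrimrecRel fun (a : α) (n : ℕ) =>
      ((Encodable.decode (α := β) n.unpair.1).elim false
        fun b => decide (R (a, b) n.unpair.2)) = true := by
    have h1 : Primrec fun x : α × ℕ => (Encodable.decode (α := β) x.2.unpair.1) :=
      Primrec.decode.comp (Primrec.fst.comp (Primrec.unpair.comp Primrec.snd))
    have h2 : Primrec₂ fun (x : α × ℕ) (b : β) => decide (R (x.1, b) x.2.unpair.2) :=
      hR.decide.comp (Primrec.pair (Primrec.fst.comp Primrec.fst) Primrec.snd)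
        (Primrec.snd.comp (Primrec.unpair.comp (Primrec.snd.comp Primrec.fst)))
    have h3 : Primrec fun x : α × ℕ => (Encodable.decode (α := β) x.2.unpair.1).elim false
        fun b => decide (R (x.1, b) x.2.unpair.2) :=
      (Primrec.option_casesOn h1 (Primrec.const false) h2).of_eq fun x => by
        cases Encodable.decode (α := β) x.2.unpair.1 <;> rfl
    exact Primrec.eq.comp h3 (Primrec.const true)
  refine (REPred.of_exists_primrecRel key).of_eq fun a => ?_
  constructor
  · rintro ⟨n, hn⟩
    cases hd : Encodable.decode (α := β) n.unpair.1 with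
    | none => simp [hd] at hn
    | some b =>
      rw [hd] at hn
      exact ⟨b, (h _).2 ⟨_, of_decide_eq_true hn⟩⟩
  · rintro ⟨b, hb⟩
    obtain ⟨n, hn⟩ := (h _).1 hb
    exact ⟨Nat.pair (Encodable.encode b) n, by simpa using hn⟩

theorem REPred.and {p q : α → Prop} (hp : REPred p) (hq : REPred q) :
    REPred fun a => p a ∧ q a := by
  obtain ⟨R, hR, mR, h⟩ := hp.exists_primrecRel
  obtain ⟨R', hR', mR', h'⟩ := hq.exists_primrecRel
  have key : PrimrecRel fun (a : α) (n : ℕ) => R a n ∧ R' a n := PrimrecPred.and hR hR'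
  refine (REPred.of_exists_primrecRel key).of_eq fun a => ?_
  rw [h, h']
  constructor
  · rintro ⟨n, h1, h2⟩
    exact ⟨⟨n, h1⟩, ⟨n, h2⟩⟩
  · rintro ⟨⟨n, h1⟩, ⟨m, h2⟩⟩
    exact ⟨max n m, mR _ _ _ (le_max_left _ _) h1, mR' _ _ _ (le_max_right _ _) h2⟩

theorem REPred.or {p q : α → Prop} (hp : REPred p) (hq : REPred q) :
    REPred fun a => p a ∨ q a := by
  obtain ⟨R, hR, mR, h⟩ := hp.exists_primrecRel
  obtain ⟨R', hR', mR', h'⟩ := hq.exists_primrecRel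
  have key : PrimrecRel fun (a : α) (n : ℕ) => R a n ∨ R' a n := PrimrecPred.or hR hR'
  refine (REPred.of_exists_primrecRel key).of_eq fun a => ?_
  rw [h, h', exists_or]

/-- Finitely many stages have a maximum, and stages are monotone, so one common stage suffices for
the list. -/
theorem REPred.forall_mem_list {p : α × β → Prop} (hp : REPred p) :
    REPred fun x : α × List β => ∀ b ∈ x.2, p (x.1, b) := by
  obtain ⟨R, hR, mR, h⟩ := hp.exists_primrecRel
  have h1 : PrimrecRel fun (b : β) (x : α × ℕ) => R (x.1, b) x.2 :=
    PrimrecRel.comp hR (Primrec.pair (Primrec.fst.comp Primrec.snd) Primrec.fst)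
      (Primrec.snd.comp Primrec.snd)
  have key : PrimrecRel fun (x : α × List β) (n : ℕ) => ∀ b ∈ x.2, R (x.1, b) n :=
    h1.forall_mem_list.comp (Primrec.snd.comp Primrec.fst)
      (Primrec.pair (Primrec.fst.comp Primrec.fst) Primrec.snd)
  refine (REPred.of_exists_primrecRel key).of_eq fun x => ?_
  constructor
  · rintro ⟨n, hn⟩ b hb
    exact (h _).2 ⟨n, hn b hb⟩
  · intro H
    exact exists_stage_forall_mem_list (R := fun b n => R (x.1, b) n)
      (fun b m n hmn => mR _ _ _ hmn) x.2 fun b hb => (h _).1 (H b hb)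

theorem REPred.exists_mem_list {p : α × β → Prop} (hp : REPred p) :
    REPred fun x : α × List β => ∃ b ∈ x.2, p (x.1, b) := by
  obtain ⟨R, hR, mR, h⟩ := hp.exists_primrecRel
  have h1 : PrimrecRel fun (b : β) (x : α × ℕ) => R (x.1, b) x.2 :=
    PrimrecRel.comp hR (Primrec.pair (Primrec.fst.comp Primrec.snd) Primrec.fst)
      (Primrec.snd.comp Primrec.snd)
  have key : PrimrecRel fun (x : α × List β) (n : ℕ) => ∃ b ∈ x.2, R (x.1, b) n :=
    h1.exists_mem_list.comp (Primrec.snd.comp Primrec.fst)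
      (Primrec.pair (Primrec.fst.comp Primrec.fst) Primrec.snd)
  refine (REPred.of_exists_primrecRel key).of_eq fun x => ?_
  simp only [h]
  exact ⟨fun ⟨n, b, hb, hn⟩ => ⟨b, hb, n, hn⟩, fun ⟨b, hb, n, hn⟩ => ⟨n, b, hb, hn⟩⟩

/-- Uniformization: a total recursively enumerable relation contains a computable function. -/
theorem REPred.exists_computable {p : α × β → Prop} (hp : REPred p) (h : ∀ a, ∃ b, p (a, b)) :
    ∃ f : α → β, Computable f ∧ ∀ a, p (a, f a) := by
  obtain ⟨R, hR, -, hpR⟩ := hp.exists_primrecRel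
  classical
  -- `n` codes a candidate and a stage; the first candidate confirmed at its stage is the value.
  let g : α → ℕ → Option β := fun a n => (Encodable.decode (α := β) n.unpair.1).bind
    fun b => if R (a, b) n.unpair.2 then some b else none
  have hg : Primrec₂ g := by
    have h1 : Primrec fun x : α × ℕ => (Encodable.decode (α := β) x.2.unpair.1) :=
      Primrec.decode.comp (Primrec.fst.comp (Primrec.unpair.comp Primrec.snd))
    have h2 : Primrec₂ fun (x : α × ℕ) (b : β) =>
        if R (x.1, b) x.2.unpair.2 then some b else none :=
      Primrec.ite (PrimrecRel.comp hR
        (Primrec.pair (Primrec.fst.comp Primrec.fst) Primrec.snd)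
        (Primrec.snd.comp (Primrec.unpair.comp (Primrec.snd.comp Primrec.fst))))
        (Primrec.option_some.comp Primrec.snd) (Primrec.const none)
    exact Primrec.option_bind h1 h2
  have hmem : ∀ a b n, b ∈ g a n → p (a, b) := by
    intro a b n hb
    obtain ⟨b', -, hb'⟩ := Option.bind_eq_some_iff.1 hb
    split_ifs at hb' with hR'
    cases hb'
    exact (hpR _).2 ⟨_, hR'⟩
  have hdom : ∀ a, (Nat.rfindOpt (g a)).Dom := by
    intro a
    rw [Nat.rfindOpt_dom]
    obtain ⟨b, hb⟩ := h a
    obtain ⟨n, hn⟩ := (hpR _).1 hb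
    exact ⟨Nat.pair (Encodable.encode b) n, b, by simp [g, hn]⟩
  refine ⟨fun a => (Nat.rfindOpt (g a)).get (hdom a), ?_, fun a => ?_⟩
  · exact (Partrec.rfindOpt hg.to_comp).of_eq fun a => (Part.some_get (hdom a)).symm
  · obtain ⟨n, hn⟩ := Nat.rfindOpt_spec (Part.get_mem (hdom a))
    exact hmem _ _ _ hn

end RecursivelyEnumerable

/-! ### Rational radii and effectively open families. -/

theorem posRat_pos (q : ℕ × ℕ) : 0 < posRat q := by
  unfold posRat
  positivity

theorem exists_posRat_lt {δ : ℝ} (hδ : 0 < δ) : ∃ q : ℕ × ℕ, posRat q < δ := by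
  obtain ⟨n, hn⟩ := exists_nat_one_div_lt hδ
  exact ⟨(0, n), by simpa [posRat] using hn⟩

theorem basicBall_prod {Y Z : Type*} [PseudoMetricSpace Y] [PseudoMetricSpace Z]
    {ι κ : Type} (β : ι → Y) (γ : κ → Z) (c : (ι × κ) × ℕ × ℕ) :
    basicBall (fun x : ι × κ => (β x.1, γ x.2)) c =
      basicBall β (c.1.1, c.2) ×ˢ basicBall γ (c.1.2, c.2) :=
  (ball_prod_same _ _ _).symm

section EffectivelyOpen

variable {Y Z : Type*} [PseudoMetricSpace Y] [PseudoMetricSpace Z] {ι κ : Type} [Primcodable ι]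
  [Primcodable κ] {π π' : Type*} [Primcodable π] [Primcodable π']

/-- A family of sets is effectively open if one enumerates, uniformly in the parameter, basic balls
contained in the set, among which are all sufficiently small balls around each of its points. -/
def IsEffectivelyOpen (β : ι → Y) (O : π → Set Y) : Prop :=
  ∃ E : π × (ι × ℕ × ℕ) → Prop, REPred E ∧ (∀ p c, E (p, c) → basicBall β c ⊆ O p) ∧
    ∀ p, ∀ y ∈ O p, ∃ δ > 0, ∀ c : ι × ℕ × ℕ, posRat c.2 < δ → y ∈ basicBall β c → E (p, c)

theorem IsEffectivelyOpen.comp {β : ι → Y} {O : π → Set Y} (hO : IsEffectivelyOpen β O)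
    {f : π' → π} (hf : Computable f) : IsEffectivelyOpen β fun p => O (f p) := by
  obtain ⟨E, hE, h1, h2⟩ := hO
  exact ⟨fun x => E (f x.1, x.2),
    hE.comp (Computable.pair (hf.comp Computable.fst) Computable.snd), fun p => h1 (f p),
    fun p => h2 (f p)⟩

theorem IsEffectivelyOpen.union {β : ι → Y} {O O' : π → Set Y} (hO : IsEffectivelyOpen β O)
    (hO' : IsEffectivelyOpen β O') : IsEffectivelyOpen β fun p => O p ∪ O' p := by
  obtain ⟨E, hE, h1, h2⟩ := hO
  obtain ⟨E', hE', h1', h2'⟩ := hO'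
  refine ⟨fun x => E x ∨ E' x, hE.or hE', ?_, ?_⟩
  · rintro p c (h | h)
    · exact (h1 p c h).trans Set.subset_union_left
    · exact (h1' p c h).trans Set.subset_union_right
  · rintro p y (hy | hy)
    · obtain ⟨δ, hδ, h⟩ := h2 p y hy
      exact ⟨δ, hδ, fun c hc hyc => Or.inl (h c hc hyc)⟩
    · obtain ⟨δ, hδ, h⟩ := h2' p y hy
      exact ⟨δ, hδ, fun c hc hyc => Or.inr (h c hc hyc)⟩

/-- A ball of the product has the same radius in both factors. Since all sufficiently small balls
are enumerated in each factor, a common radius is available; this is the benefit of that clause over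
a mere union of balls. -/
theorem IsEffectivelyOpen.prod {β : ι → Y} {γ : κ → Z} {O : π → Set Y} {O' : π → Set Z}
    (hO : IsEffectivelyOpen β O) (hO' : IsEffectivelyOpen γ O') :
    IsEffectivelyOpen (fun x : ι × κ => (β x.1, γ x.2)) fun p => O p ×ˢ O' p := by
  obtain ⟨E, hE, h1, h2⟩ := hO
  obtain ⟨E', hE', h1', h2'⟩ := hO'
  refine ⟨fun x => E (x.1, x.2.1.1, x.2.2) ∧ E' (x.1, x.2.1.2, x.2.2),
    (hE.comp ?_).and (hE'.comp ?_), ?_, ?_⟩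
  · exact (Primrec.pair Primrec.fst (Primrec.pair (Primrec.fst.comp (Primrec.fst.comp
      Primrec.snd)) (Primrec.snd.comp Primrec.snd))).to_comp
  · exact (Primrec.pair Primrec.fst (Primrec.pair (Primrec.snd.comp (Primrec.fst.comp
      Primrec.snd)) (Primrec.snd.comp Primrec.snd))).to_comp
  · rintro p c ⟨h, h'⟩
    rw [basicBall_prod]
    exact Set.prod_mono (h1 p _ h) (h1' p _ h')
  · rintro p ⟨y, z⟩ ⟨hy, hz⟩
    obtain ⟨δ, hδ, h⟩ := h2 p y hy
    obtain ⟨δ', hδ', h'⟩ := h2' p z hz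
    refine ⟨min δ δ', lt_min hδ hδ', fun c hc hyc => ?_⟩
    rw [basicBall_prod] at hyc
    exact ⟨h _ (hc.trans_le (min_le_left _ _)) hyc.1, h' _ (hc.trans_le (min_le_right _ _)) hyc.2⟩

/-- An effectively open family of sets is a uniformly enumerable union of basic balls. -/
theorem IsEffectivelyOpen.exists_eq_iUnion {β : ι → Y} (hβ : DenseRange β) {O : π → Set Y}
    (hO : IsEffectivelyOpen β O) : ∃ E : π × (ι × ℕ × ℕ) → Prop, REPred E ∧
      ∀ p, O p = ⋃ (c) (_ : E (p, c)), basicBall β c := by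
  obtain ⟨E, hE, h1, h2⟩ := hO
  refine ⟨E, hE, fun p => Set.Subset.antisymm (fun y hy => ?_) (Set.iUnion₂_subset (h1 p))⟩
  obtain ⟨δ, hδ, h⟩ := h2 p y hy
  obtain ⟨q, hq⟩ := exists_posRat_lt hδ
  obtain ⟨i, hi⟩ := hβ.exists_dist_lt y (posRat_pos q)
  exact Set.mem_iUnion₂.2 ⟨(i, q), h (i, q) hq hi, hi⟩

theorem IsEffectivelyOpen.isOpen {β : ι → Y} (hβ : DenseRange β) {O : π → Set Y}
    (hO : IsEffectivelyOpen β O) (p : π) : IsOpen (O p) := by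
  obtain ⟨E, -, h⟩ := hO.exists_eq_iUnion hβ
  rw [h]
  exact isOpen_biUnion fun _ _ => Metric.isOpen_ball

/-- By compactness the inclusion is witnessed by a finite list of enumerated balls covering `C`, and
both properties of the list are enumerable. -/
theorem IsEffectivelyCompact.rePred_subset {β : ι → Y} (hβ : DenseRange β) {C : Set Y}
    (hC : IsEffectivelyCompact β C) {O : π → Set Y} (hO : IsEffectivelyOpen β O) :
    REPred fun p => C ⊆ O p := by
  obtain ⟨E, hE, h⟩ := hO.exists_eq_iUnion hβ
  have key : REPred fun p : π => ∃ L : List (ι × ℕ × ℕ),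
      (∀ c ∈ L, E (p, c)) ∧ C ⊆ ⋃ c ∈ L, basicBall β c :=
    (hE.forall_mem_list.and (hC.2.comp Computable.snd)).exists
  refine key.of_eq fun p => ⟨?_, fun hp => ?_⟩
  · rintro ⟨L, hL, hCL⟩
    rw [h]
    exact hCL.trans (Set.iUnion₂_mono' fun c hc => ⟨c, hL c hc, subset_rfl⟩)
  · rw [h] at hp
    obtain ⟨t, ht, htf, hCt⟩ := hC.1.elim_finite_subcover_image (b := {c | E (p, c)})
      (fun c _ => Metric.isOpen_ball) hp
    refine ⟨htf.toFinset.toList, fun c hc => ht (by simpa using hc), fun y hy => ?_⟩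
    simpa [basicBall] using hCt hy

end EffectivelyOpen

/-! ### Finite unions of balls and complements of closed balls are effectively open. -/

section BallLists

variable {X : Type*} [MetricSpace X]

theorem primrec_two_pow : Primrec fun n : ℕ => 2 ^ n := by
  refine (Primrec.nat_rec₁ (f := fun _ y => 2 * y) 1 ?_).of_eq fun n => ?_
  · exact Primrec.nat_mul.comp (Primrec.const 2) Primrec.snd
  · induction n with
    | zero => rfl
    | succ n ih => rw [pow_succ, ← ih, mul_comm]

theorem exists_approx_add_lt_iff {x y : ℝ} {a : ℕ → ℝ} (h : ∀ k, |x - a k| ≤ 2⁻¹ ^ k) :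
    x < y ↔ ∃ k, a k + 2⁻¹ ^ k < y := by
  constructor
  · intro hxy
    obtain ⟨k, hk⟩ := exists_pow_lt_of_lt_one (half_pos (sub_pos.2 hxy))
      (by norm_num : (2⁻¹ : ℝ) < 1)
    have := abs_le.1 (h k)
    exact ⟨k, by linarith⟩
  · rintro ⟨k, hk⟩
    have := abs_le.1 (h k)
    linarith

theorem exists_lt_approx_sub_iff {x y : ℝ} {a : ℕ → ℝ} (h : ∀ k, |x - a k| ≤ 2⁻¹ ^ k) :
    y < x ↔ ∃ k, y + 2⁻¹ ^ k < a k := by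
  constructor
  · intro hxy
    obtain ⟨k, hk⟩ := exists_pow_lt_of_lt_one (half_pos (sub_pos.2 hxy))
      (by norm_num : (2⁻¹ : ℝ) < 1)
    have := abs_le.1 (h k)
    exact ⟨k, by linarith⟩
  · rintro ⟨k, hk⟩
    have := abs_le.1 (h k)
    linarith

/-- Clearing denominators turns the comparison into a primitive recursive one between natural
numbers. -/
theorem rat_add_half_pow_add_lt_iff (n m k a b c d : ℕ) :
    (n : ℝ) / ((m : ℝ) + 1) + 2⁻¹ ^ k + ((a : ℝ) + 1) / ((b : ℝ) + 1) <
        ((c : ℝ) + 1) / ((d : ℝ) + 1) ↔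
      ((n * 2 ^ k + (m + 1)) * (b + 1) + (a + 1) * ((m + 1) * 2 ^ k)) * (d + 1) <
        (c + 1) * (((m + 1) * 2 ^ k) * (b + 1)) := by
  rw [← Nat.cast_lt (α := ℝ), inv_pow, inv_eq_one_div,
    div_add_div _ _ (by positivity) (by positivity),
    div_add_div _ _ (by positivity) (by positivity),
    div_lt_div_iff₀ (by positivity) (by positivity)]
  push_cast
  ring_nf

theorem rat_add_half_pow_lt_iff (n m k a b c d : ℕ) :
    ((a : ℝ) + 1) / ((b : ℝ) + 1) + ((c : ℝ) + 1) / ((d : ℝ) + 1) + 2⁻¹ ^ k <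
        (n : ℝ) / ((m : ℝ) + 1) ↔
      (((a + 1) * (d + 1) + (b + 1) * (c + 1)) * 2 ^ k + (b + 1) * (d + 1)) * (m + 1) <
        n * (((b + 1) * (d + 1)) * 2 ^ k) := by
  rw [← Nat.cast_lt (α := ℝ), inv_pow, inv_eq_one_div,
    div_add_div _ _ (by positivity) (by positivity),
    div_add_div _ _ (by positivity) (by positivity),
    div_lt_div_iff₀ (by positivity) (by positivity)]
  push_cast
  ring_nf

/-- This is formal inclusion of one ball in another, a strict inequality on codes;
`rePred_add_lt_dist` likewise expresses formal disjointness. -/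
theorem ConstructiveMetricSpace.rePred_dist_add_lt (S : ConstructiveMetricSpace X) :
    REPred fun x : (ℕ × ℕ) × (ℕ × ℕ) × (ℕ × ℕ) =>
      dist (S.pt x.1.1) (S.pt x.1.2) + posRat x.2.1 < posRat x.2.2 := by
  obtain ⟨f, hf, h⟩ := S.computable_dist
  have key : PrimrecPred fun z : (ℕ × ℕ) × ℕ × (ℕ × ℕ) × (ℕ × ℕ) =>
      ((z.1.1 * 2 ^ z.2.1 + (z.1.2 + 1)) * (z.2.2.1.2 + 1) +
        (z.2.2.1.1 + 1) * ((z.1.2 + 1) * 2 ^ z.2.1)) * (z.2.2.2.2 + 1) <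
      (z.2.2.2.1 + 1) * (((z.1.2 + 1) * 2 ^ z.2.1) * (z.2.2.1.2 + 1)) := by
    have hn := Primrec.fst.comp (Primrec.fst (α := ℕ × ℕ) (β := ℕ × (ℕ × ℕ) × (ℕ × ℕ)))
    have hm := Primrec.succ.comp
      (Primrec.snd.comp (Primrec.fst (α := ℕ × ℕ) (β := ℕ × (ℕ × ℕ) × (ℕ × ℕ))))
    have hs := Primrec.snd (α := ℕ × ℕ) (β := ℕ × (ℕ × ℕ) × (ℕ × ℕ))
    have hk := primrec_two_pow.comp (Primrec.fst.comp hs)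
    have ha := Primrec.succ.comp (Primrec.fst.comp (Primrec.fst.comp (Primrec.snd.comp hs)))
    have hb := Primrec.succ.comp (Primrec.snd.comp (Primrec.fst.comp (Primrec.snd.comp hs)))
    have hc := Primrec.succ.comp (Primrec.fst.comp (Primrec.snd.comp (Primrec.snd.comp hs)))
    have hd := Primrec.succ.comp (Primrec.snd.comp (Primrec.snd.comp (Primrec.snd.comp hs)))
    have mul {u v : (ℕ × ℕ) × ℕ × (ℕ × ℕ) × (ℕ × ℕ) → ℕ} (hu : Primrec u) (hv : Primrec v) :
        Primrec fun z => u z * v z := Primrec.nat_mul.comp hu hv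
    exact Primrec.nat_lt.comp
      (mul (Primrec.nat_add.comp (mul (Primrec.nat_add.comp (mul hn hk) hm) hb)
        (mul ha (mul hm hk))) hd) (mul hc (mul (mul hm hk) hb))
  have hg : Computable fun x : ((ℕ × ℕ) × (ℕ × ℕ) × (ℕ × ℕ)) × ℕ =>
      (f (x.1.1.1, x.1.1.2, x.2), x.2, x.1.2) := by
    refine Computable.pair (hf.comp (Primrec.to_comp ?_)) (Primrec.to_comp ?_)
    · exact Primrec.pair (Primrec.fst.comp (Primrec.fst.comp Primrec.fst))
        (Primrec.pair (Primrec.snd.comp (Primrec.fst.comp Primrec.fst)) Primrec.snd)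
    · exact Primrec.pair Primrec.snd (Primrec.snd.comp Primrec.fst)
  refine (key.rePred.comp hg).exists.of_eq fun ⟨⟨m, n⟩, ⟨a, b⟩, ⟨c, d⟩⟩ => ?_
  rw [← lt_sub_iff_add_lt, exists_approx_add_lt_iff (h m n)]
  simp only [lt_sub_iff_add_lt, posRat]
  exact exists_congr fun k => (rat_add_half_pow_add_lt_iff _ _ k a b c d).symm

theorem ConstructiveMetricSpace.rePred_add_lt_dist (S : ConstructiveMetricSpace X) :
    REPred fun x : (ℕ × ℕ) × (ℕ × ℕ) × (ℕ × ℕ) =>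
      posRat x.2.1 + posRat x.2.2 < dist (S.pt x.1.1) (S.pt x.1.2) := by
  obtain ⟨f, hf, h⟩ := S.computable_dist
  have key : PrimrecPred fun z : (ℕ × ℕ) × ℕ × (ℕ × ℕ) × (ℕ × ℕ) =>
      (((z.2.2.1.1 + 1) * (z.2.2.2.2 + 1) + (z.2.2.1.2 + 1) * (z.2.2.2.1 + 1)) * 2 ^ z.2.1 +
        (z.2.2.1.2 + 1) * (z.2.2.2.2 + 1)) * (z.1.2 + 1) <
      z.1.1 * (((z.2.2.1.2 + 1) * (z.2.2.2.2 + 1)) * 2 ^ z.2.1) := by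
    have hn := Primrec.fst.comp (Primrec.fst (α := ℕ × ℕ) (β := ℕ × (ℕ × ℕ) × (ℕ × ℕ)))
    have hm := Primrec.succ.comp
      (Primrec.snd.comp (Primrec.fst (α := ℕ × ℕ) (β := ℕ × (ℕ × ℕ) × (ℕ × ℕ))))
    have hs := Primrec.snd (α := ℕ × ℕ) (β := ℕ × (ℕ × ℕ) × (ℕ × ℕ))
    have hk := primrec_two_pow.comp (Primrec.fst.comp hs)
    have ha := Primrec.succ.comp (Primrec.fst.comp (Primrec.fst.comp (Primrec.snd.comp hs)))
    have hb := Primrec.succ.comp (Primrec.snd.comp (Primrec.fst.comp (Primrec.snd.comp hs)))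
    have hc := Primrec.succ.comp (Primrec.fst.comp (Primrec.snd.comp (Primrec.snd.comp hs)))
    have hd := Primrec.succ.comp (Primrec.snd.comp (Primrec.snd.comp (Primrec.snd.comp hs)))
    have mul {u v : (ℕ × ℕ) × ℕ × (ℕ × ℕ) × (ℕ × ℕ) → ℕ} (hu : Primrec u) (hv : Primrec v) :
        Primrec fun z => u z * v z := Primrec.nat_mul.comp hu hv
    exact Primrec.nat_lt.comp
      (mul (Primrec.nat_add.comp (mul (Primrec.nat_add.comp (mul ha hd) (mul hb hc)) hk)
        (mul hb hd)) hm) (mul hn (mul (mul hb hd) hk))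
  have hg : Computable fun x : ((ℕ × ℕ) × (ℕ × ℕ) × (ℕ × ℕ)) × ℕ =>
      (f (x.1.1.1, x.1.1.2, x.2), x.2, x.1.2) := by
    refine Computable.pair (hf.comp (Primrec.to_comp ?_)) (Primrec.to_comp ?_)
    · exact Primrec.pair (Primrec.fst.comp (Primrec.fst.comp Primrec.fst))
        (Primrec.pair (Primrec.snd.comp (Primrec.fst.comp Primrec.fst)) Primrec.snd)
    · exact Primrec.pair Primrec.snd (Primrec.snd.comp Primrec.fst)
  refine (key.rePred.comp hg).exists.of_eq fun ⟨⟨m, n⟩, ⟨a, b⟩, ⟨c, d⟩⟩ => ?_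
  rw [exists_lt_approx_sub_iff (h m n)]
  simp only [posRat]
  exact exists_congr fun k => (rat_add_half_pow_lt_iff _ _ k a b c d).symm

/-- The union of a finite list of basic balls. -/
def ballUnion (α : ℕ → X) (L : List (ℕ × ℕ × ℕ)) : Set X := ⋃ c ∈ L, basicBall α c

/-- The complement of the union of the closed balls with codes in a finite list. -/
def closedBallUnionCompl (α : ℕ → X) (L : List (ℕ × ℕ × ℕ)) : Set X :=
  {x | ∀ c ∈ L, posRat c.2 < dist x (α c.1)}

/-- The list of the balls with the same centers and twice the radii. -/
def doubleRadii (L : List (ℕ × ℕ × ℕ)) : List (ℕ × ℕ × ℕ) :=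
  L.map fun c => (c.1, 2 * c.2.1 + 1, c.2.2)

/-- The code stores the numerator minus one, and `2 * (a + 1) = (2 * a + 1) + 1`. -/
theorem posRat_double (q : ℕ × ℕ) : posRat (2 * q.1 + 1, q.2) = 2 * posRat q := by
  simp only [posRat]
  push_cast
  ring

theorem primrec_doubleRadii : Primrec doubleRadii := by
  have h : Primrec fun c : ℕ × ℕ × ℕ => (c.1, 2 * c.2.1 + 1, c.2.2) :=
    Primrec.pair Primrec.fst (Primrec.pair (Primrec.succ.comp (Primrec.nat_mul.comp
      (Primrec.const 2) (Primrec.fst.comp Primrec.snd))) (Primrec.snd.comp Primrec.snd))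
  exact Primrec.list_map Primrec.id (h.comp Primrec.snd).to₂

theorem mem_ballUnion {α : ℕ → X} {L : List (ℕ × ℕ × ℕ)} {x : X} :
    x ∈ ballUnion α L ↔ ∃ c ∈ L, dist x (α c.1) < posRat c.2 := by
  simp [ballUnion, basicBall]

theorem mem_ballUnion_doubleRadii {α : ℕ → X} {L : List (ℕ × ℕ × ℕ)} {x : X} :
    x ∈ ballUnion α (doubleRadii L) ↔ ∃ c ∈ L, dist x (α c.1) < 2 * posRat c.2 := by
  simp only [mem_ballUnion, doubleRadii, List.mem_map, exists_exists_and_eq_and, posRat_double]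

theorem mem_closedBallUnionCompl_doubleRadii {α : ℕ → X} {L : List (ℕ × ℕ × ℕ)} {x : X} :
    x ∈ closedBallUnionCompl α (doubleRadii L) ↔ ∀ c ∈ L, 2 * posRat c.2 < dist x (α c.1) := by
  simp only [closedBallUnionCompl, doubleRadii, Set.mem_ofPred_eq, List.forall_mem_map,
    posRat_double]

/-- Doubling the radii creates the overlap needed for two open sets to cover `X`; with the original
radii they are only disjoint. -/
theorem mem_closedBallUnionCompl_or_mem_ballUnion (α : ℕ → X) (L : List (ℕ × ℕ × ℕ)) (x : X) :
    x ∈ closedBallUnionCompl α L ∨ x ∈ ballUnion α (doubleRadii L) := by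
  rw [mem_ballUnion_doubleRadii, or_iff_not_imp_left]
  intro h
  simp only [closedBallUnionCompl, Set.mem_ofPred_eq, not_forall, not_lt] at h
  obtain ⟨c, hc, h⟩ := h
  exact ⟨c, hc, h.trans_lt (by linarith [posRat_pos c.2])⟩

theorem closedBallUnionCompl_subset_compl (α : ℕ → X) (L : List (ℕ × ℕ × ℕ)) :
    closedBallUnionCompl α L ⊆ (ballUnion α L)ᶜ := by
  intro x hx h
  obtain ⟨c, hc, h⟩ := mem_ballUnion.1 h
  exact lt_asymm h (hx c hc)

theorem isOpen_ballUnion (α : ℕ → X) (L : List (ℕ × ℕ × ℕ)) : IsOpen (ballUnion α L) :=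
  isOpen_biUnion fun _ _ => Metric.isOpen_ball

theorem isEffectivelyOpen_ballUnion (S : ConstructiveMetricSpace X) :
    IsEffectivelyOpen S.pt (ballUnion S.pt) := by
  have h1 : REPred fun x : (ℕ × ℕ × ℕ) × (ℕ × ℕ × ℕ) =>
      dist (S.pt x.1.1) (S.pt x.2.1) + posRat x.1.2 < posRat x.2.2 := by
    refine S.rePred_dist_add_lt.comp (f := fun x : (ℕ × ℕ × ℕ) × (ℕ × ℕ × ℕ) =>
      ((x.1.1, x.2.1), (x.1.2, x.2.2))) (Primrec.to_comp ?_)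
    exact Primrec.pair (Primrec.pair (Primrec.fst.comp Primrec.fst) (Primrec.fst.comp Primrec.snd))
      (Primrec.pair (Primrec.snd.comp Primrec.fst) (Primrec.snd.comp Primrec.snd))
  refine ⟨fun x => ∃ b ∈ x.1, dist (S.pt x.2.1) (S.pt b.1) + posRat x.2.2 < posRat b.2,
    h1.exists_mem_list.comp (Computable.pair Computable.snd Computable.fst), ?_, ?_⟩
  · rintro L c ⟨b, hb, h⟩ x hx
    have hx' : dist x (S.pt c.1) < posRat c.2 := hx
    have h' : dist (S.pt c.1) (S.pt b.1) + posRat c.2 < posRat b.2 := h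
    exact mem_ballUnion.2 ⟨b, hb, by linarith [dist_triangle x (S.pt c.1) (S.pt b.1)]⟩
  · intro L x hx
    obtain ⟨b, hb, h⟩ := mem_ballUnion.1 hx
    -- Half of the gap: the radius of `c` counts once for its center being off `x` and once for the
    -- ball itself.
    refine ⟨(posRat b.2 - dist x (S.pt b.1)) / 2, by linarith, fun c hc hxc => ⟨b, hb, ?_⟩⟩
    have hx' : dist x (S.pt c.1) < posRat c.2 := hxc
    have := dist_triangle_left (S.pt c.1) (S.pt b.1) x
    change dist (S.pt c.1) (S.pt b.1) + posRat c.2 < posRat b.2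
    linarith

theorem exists_pos_forall_mem_list {β : Type*} {p : β → ℝ → Prop} (l : List β)
    (h : ∀ b ∈ l, ∃ δ > 0, ∀ ε < δ, p b ε) : ∃ δ > 0, ∀ ε < δ, ∀ b ∈ l, p b ε := by
  induction l with
  | nil => exact ⟨1, one_pos, by simp⟩
  | cons b l ih =>
    obtain ⟨δ, hδ, hb⟩ := h b (by simp)
    obtain ⟨δ', hδ', hl⟩ := ih fun b hb => h b (by simp [hb])
    refine ⟨min δ δ', lt_min hδ hδ', fun ε hε => List.forall_mem_cons.2 ⟨hb ε ?_, hl ε ?_⟩⟩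
    · exact hε.trans_le (min_le_left _ _)
    · exact hε.trans_le (min_le_right _ _)

theorem isEffectivelyOpen_closedBallUnionCompl (S : ConstructiveMetricSpace X) :
    IsEffectivelyOpen S.pt (closedBallUnionCompl S.pt) := by
  have h1 : REPred fun x : (ℕ × ℕ × ℕ) × (ℕ × ℕ × ℕ) =>
      posRat x.1.2 + posRat x.2.2 < dist (S.pt x.1.1) (S.pt x.2.1) := by
    refine S.rePred_add_lt_dist.comp (f := fun x : (ℕ × ℕ × ℕ) × (ℕ × ℕ × ℕ) =>
      ((x.1.1, x.2.1), (x.1.2, x.2.2))) (Primrec.to_comp ?_)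
    exact Primrec.pair (Primrec.pair (Primrec.fst.comp Primrec.fst) (Primrec.fst.comp Primrec.snd))
      (Primrec.pair (Primrec.snd.comp Primrec.fst) (Primrec.snd.comp Primrec.snd))
  refine ⟨fun x => ∀ b ∈ x.1, posRat x.2.2 + posRat b.2 < dist (S.pt x.2.1) (S.pt b.1),
    h1.forall_mem_list.comp (Computable.pair Computable.snd Computable.fst), ?_, ?_⟩
  · intro L c h x hx b hb
    have hx' : dist x (S.pt c.1) < posRat c.2 := hx
    have h' : posRat c.2 + posRat b.2 < dist (S.pt c.1) (S.pt b.1) := h b hb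
    linarith [dist_triangle_left (S.pt c.1) (S.pt b.1) x]
  · intro L x hx
    obtain ⟨δ, hδ, h⟩ := exists_pos_forall_mem_list
      (p := fun b ε => 2 * ε + posRat b.2 < dist x (S.pt b.1)) L fun b hb =>
        ⟨(dist x (S.pt b.1) - posRat b.2) / 2, by linarith [hx b hb], fun ε hε => by linarith⟩
    refine ⟨δ, hδ, fun c hc hxc b hb => ?_⟩
    have hx' : dist x (S.pt c.1) < posRat c.2 := hxc
    have := h _ hc b hb
    change posRat c.2 + posRat b.2 < dist (S.pt c.1) (S.pt b.1)
    linarith [dist_triangle x (S.pt c.1) (S.pt b.1)]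

end BallLists

/-! ### Masses of finitely supported measures as quotients of integer weights. -/

section MeasureCodes

theorem primrec_sum_map {γ δ : Type*} [Primcodable γ] [Primcodable δ] {f : γ → List δ}
    {g : γ → δ → ℕ} (hf : Primrec f) (hg : Primrec₂ g) :
    Primrec fun a => ((f a).map (g a)).sum := by
  refine (Primrec.list_foldr (Primrec.list_map hf hg) (Primrec.const 0)
    (h := fun _ x => x.1 + x.2) ?_).of_eq fun a => rfl
  exact Primrec.nat_add.comp (Primrec.fst.comp Primrec.snd) (Primrec.snd.comp Primrec.snd)

open Classical in
/-- The total weight of the entries of a list of weighted points whose points satisfy a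
predicate. -/
noncomputable def listWeight (J : ℕ → Prop) (l : List (ℕ × ℕ)) : ℕ :=
  (l.map fun x => if J x.1 then x.2 + 1 else 0).sum

theorem listWeight_mono {J J' : ℕ → Prop} {l : List (ℕ × ℕ)} (h : ∀ x ∈ l, J x.1 → J' x.1) :
    listWeight J l ≤ listWeight J' l := by
  refine List.sum_le_sum fun x hx => ?_
  have := h x hx
  split_ifs <;> simp_all

variable {X : Type*} [MeasurableSpace X]

theorem listMeasure_cons (α : ℕ → X) (p : ℕ × ℕ) (l : List (ℕ × ℕ)) (B : Set X) :
    listMeasure α (p :: l) B =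
      ((p.2 + 1 : ℕ) : ℝ≥0∞) * Measure.dirac (α p.1) B + listMeasure α l B := by
  simp [listMeasure]

theorem listWeight_cons_of_pos {J : ℕ → Prop} {p : ℕ × ℕ} (l : List (ℕ × ℕ)) (h : J p.1) :
    listWeight J (p :: l) = p.2 + 1 + listWeight J l := by
  simp [listWeight, h]

theorem listWeight_cons_of_neg {J : ℕ → Prop} {p : ℕ × ℕ} (l : List (ℕ × ℕ)) (h : ¬J p.1) :
    listWeight J (p :: l) = listWeight J l := by
  simp [listWeight, h]

/-- Membership of an atom in `B` is not decidable, so it is replaced by a predicate `J` on codes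
approximating it from one side; the converse bound is `listMeasure_le_listWeight`. -/
theorem listWeight_le_listMeasure {α : ℕ → X} {J : ℕ → Prop} {B : Set X}
    (h : ∀ i, J i → α i ∈ B) (l : List (ℕ × ℕ)) : (listWeight J l : ℝ≥0∞) ≤ listMeasure α l B := by
  induction l with
  | nil => simp [listWeight]
  | cons p l ih =>
    rw [listMeasure_cons]
    by_cases hp : J p.1
    · rw [listWeight_cons_of_pos l hp, Measure.dirac_apply_of_mem (h _ hp), mul_one, Nat.cast_add]
      gcongr
    · rw [listWeight_cons_of_neg l hp]
      exact ih.trans le_add_self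

theorem listMeasure_le_listWeight {α : ℕ → X} {J : ℕ → Prop} {B : Set X} (hB : MeasurableSet B)
    (h : ∀ i, α i ∈ B → J i) (l : List (ℕ × ℕ)) : listMeasure α l B ≤ (listWeight J l : ℝ≥0∞) := by
  induction l with
  | nil => simp [listMeasure]
  | cons p l ih =>
    rw [listMeasure_cons]
    by_cases hp : J p.1
    · rw [listWeight_cons_of_pos l hp, Nat.cast_add (p.2 + 1)]
      exact add_le_add (mul_le_of_le_one_right' (prob_le_one (μ := Measure.dirac (α p.1)))) ih
    · rw [listWeight_cons_of_neg l hp, Measure.dirac_apply' _ hB,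
        Set.indicator_of_notMem fun hx => hp (h _ hx), mul_zero, zero_add]
      exact ih

theorem listMeasure_univ (α : ℕ → X) (l : List (ℕ × ℕ)) :
    listMeasure α l Set.univ = (listWeight (fun _ => True) l : ℝ≥0∞) :=
  le_antisymm (listMeasure_le_listWeight MeasurableSet.univ (fun _ _ => trivial) l)
    (listWeight_le_listMeasure (fun _ _ => Set.mem_univ _) l)

theorem measurePt_apply (α : ℕ → X) (c : (ℕ × ℕ) × List (ℕ × ℕ)) (B : Set X) :
    ((measurePt α c).toMeasure : Measure X) B =
      listMeasure α (c.1 :: c.2) B / (listWeight (fun _ => True) (c.1 :: c.2) : ℝ≥0∞) := by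
  rw [← listMeasure_univ α, ENNReal.div_eq_inv_mul]
  rfl

theorem listWeight_true_pos (p : ℕ × ℕ) (l : List (ℕ × ℕ)) :
    0 < listWeight (fun _ => True) (p :: l) := by
  rw [listWeight_cons_of_pos l trivial]
  omega

theorem nonnegRat_add_posRat_lt_div_iff (q e : ℕ × ℕ) (w W : ℕ) (hW : 0 < W) :
    nonnegRat q + ENNReal.ofReal (posRat e) < (w : ℝ≥0∞) / (W : ℝ≥0∞) ↔
      (q.1 * (e.2 + 1) + (q.2 + 1) * (e.1 + 1)) * W < w * ((q.2 + 1) * (e.2 + 1)) := by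
  have h1 : nonnegRat q = ENNReal.ofReal ((q.1 : ℝ) / ((q.2 : ℝ) + 1)) := by
    rw [ENNReal.ofReal_div_of_pos (by positivity), nonnegRat,
      ENNReal.ofReal_add (by positivity) zero_le_one]
    simp
  have hW' : (0 : ℝ) < W := by exact_mod_cast hW
  have h2 : (w : ℝ≥0∞) / (W : ℝ≥0∞) = ENNReal.ofReal ((w : ℝ) / (W : ℝ)) := by
    rw [ENNReal.ofReal_div_of_pos hW']
    simp
  rw [h1, h2, ← ENNReal.ofReal_add (by positivity) (posRat_pos e).le,
    ENNReal.ofReal_lt_ofReal_iff_of_nonneg (add_nonneg (by positivity) (posRat_pos e).le), posRat,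
    div_add_div _ _ (by positivity) (by positivity), div_lt_div_iff₀ (by positivity) hW',
    ← Nat.cast_lt (α := ℝ)]
  push_cast
  rfl

end MeasureCodes

section WeightComputability

variable {π : Type*} [Primcodable π]

theorem primrec_listWeight_stage {R : π × (ℕ × ℕ × ℕ) → ℕ → Prop} (hR : PrimrecRel R) :
    Primrec fun z : ((π × (ℕ × ℕ)) × ((ℕ × ℕ) × List (ℕ × ℕ)) × (ℕ × ℕ)) × ℕ =>
      listWeight (fun j => R (z.1.1.1, j, z.1.2.2) z.2) (z.1.2.1.1 :: z.1.2.1.2) := by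
  classical
  let A := ((π × (ℕ × ℕ)) × ((ℕ × ℕ) × List (ℕ × ℕ)) × (ℕ × ℕ)) × ℕ
  have hl : Primrec fun z : A => z.1.2.1.1 :: z.1.2.1.2 := by
    have : Primrec fun z : A => z.1.2.1 := Primrec.fst.comp (Primrec.snd.comp Primrec.fst)
    exact Primrec.list_cons.comp (Primrec.fst.comp this) (Primrec.snd.comp this)
  have hp : Primrec fun y : A × (ℕ × ℕ) => (y.1.1.1.1, y.2.1, y.1.1.2.2) :=
    Primrec.pair (Primrec.fst.comp (Primrec.fst.comp (Primrec.fst.comp Primrec.fst)))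
      (Primrec.pair (Primrec.fst.comp Primrec.snd)
        (Primrec.snd.comp (Primrec.snd.comp (Primrec.fst.comp Primrec.fst))))
  have hn : Primrec fun y : A × (ℕ × ℕ) => y.1.2 := Primrec.snd.comp Primrec.fst
  have hw : Primrec fun y : A × (ℕ × ℕ) => y.2.2 + 1 :=
    Primrec.succ.comp (Primrec.snd.comp Primrec.snd)
  have hg : Primrec₂ fun (z : A) (x : ℕ × ℕ) =>
      if R (z.1.1.1, x.1, z.1.2.2) z.2 then x.2 + 1 else 0 :=
    Primrec.ite (PrimrecRel.comp hR hp hn) hw (Primrec.const 0)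
  refine (primrec_sum_map hl hg).of_eq fun z => ?_
  simp only [listWeight]

theorem rePred_lt_listWeight_div {R : π × (ℕ × ℕ × ℕ) → ℕ → Prop} (hR : PrimrecRel R) :
    REPred fun x : (π × (ℕ × ℕ)) × ((ℕ × ℕ) × List (ℕ × ℕ)) × (ℕ × ℕ) => ∃ n,
      nonnegRat x.1.2 + ENNReal.ofReal (posRat x.2.2) <
        (listWeight (fun j => R (x.1.1, j, x.2.2) n) (x.2.1.1 :: x.2.1.2) : ℝ≥0∞) /
          (listWeight (fun _ => True) (x.2.1.1 :: x.2.1.2) : ℝ≥0∞) := by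
  let A := ((π × (ℕ × ℕ)) × ((ℕ × ℕ) × List (ℕ × ℕ)) × (ℕ × ℕ)) × ℕ
  have hw := primrec_listWeight_stage hR
  have hW : Primrec fun z : A => listWeight (fun _ => True) (z.1.2.1.1 :: z.1.2.1.2) :=
    primrec_listWeight_stage (R := fun (_ : π × (ℕ × ℕ × ℕ)) (_ : ℕ) => True)
      (Primrec.primrecPred (Primrec.const true))
  have ha : Primrec fun z : A => z.1.1.2.1 :=
    Primrec.fst.comp (Primrec.snd.comp (Primrec.fst.comp Primrec.fst))
  have hb : Primrec fun z : A => z.1.1.2.2 + 1 :=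
    Primrec.succ.comp (Primrec.snd.comp (Primrec.snd.comp (Primrec.fst.comp Primrec.fst)))
  have he : Primrec fun z : A => z.1.2.2 := Primrec.snd.comp (Primrec.snd.comp Primrec.fst)
  have hc : Primrec fun z : A => z.1.2.2.1 + 1 := Primrec.succ.comp (Primrec.fst.comp he)
  have hd : Primrec fun z : A => z.1.2.2.2 + 1 := Primrec.succ.comp (Primrec.snd.comp he)
  have key : PrimrecRel fun (x : (π × (ℕ × ℕ)) × ((ℕ × ℕ) × List (ℕ × ℕ)) × (ℕ × ℕ)) (n : ℕ) =>
      (x.1.2.1 * (x.2.2.2 + 1) + (x.1.2.2 + 1) * (x.2.2.1 + 1)) *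
          listWeight (fun _ => True) (x.2.1.1 :: x.2.1.2) <
        listWeight (fun j => R (x.1.1, j, x.2.2) n) (x.2.1.1 :: x.2.1.2) *
          ((x.1.2.2 + 1) * (x.2.2.2 + 1)) := Primrec.nat_lt.comp (Primrec.nat_mul.comp (Primrec.nat_add.comp
    (Primrec.nat_mul.comp ha hd) (Primrec.nat_mul.comp hb hc)) hW)
    (Primrec.nat_mul.comp hw (Primrec.nat_mul.comp hb hd))
  refine (REPred.of_exists_primrecRel key).of_eq fun x => ?_
  exact exists_congr fun n =>
    (nonnegRat_add_posRat_lt_div_iff _ _ _ _ (listWeight_true_pos _ _)).symm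

end WeightComputability

/-! ### The measure of an effectively open set is lower semicomputable in the measure. -/

section BallCore

variable {X : Type*} [MetricSpace X]

/-- The set of points all of whose small enough basic balls satisfy a predicate. -/
def ballCore {ι : Type} (β : ι → X) (E : ι × ℕ × ℕ → Prop) (δ : ℝ) : Set X :=
  {x | ∀ c : ι × ℕ × ℕ, posRat c.2 < δ → x ∈ basicBall β c → E c}

theorem isClosed_ballCore {ι : Type} (β : ι → X) (E : ι × ℕ × ℕ → Prop) (δ : ℝ) :
    IsClosed (ballCore β E δ) := by
  have : ballCore β E δ = (⋃ c ∈ {c : ι × ℕ × ℕ | posRat c.2 < δ ∧ ¬E c}, basicBall β c)ᶜ := by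
    ext x
    simp only [ballCore, Set.mem_ofPred_eq, Set.mem_compl_iff, Set.mem_iUnion, not_exists,
      and_imp]
    exact forall_congr' fun c => ⟨fun h h1 h2 h3 => h2 (h h1 h3),
      fun h h1 h3 => not_not.1 fun h2 => h h1 h2 h3⟩
  rw [this]
  exact (isOpen_biUnion fun _ _ => Metric.isOpen_ball).isClosed_compl

theorem ballCore_anti {ι : Type} (β : ι → X) (E : ι × ℕ × ℕ → Prop) {δ δ' : ℝ} (h : δ ≤ δ') :
    ballCore β E δ' ⊆ ballCore β E δ :=
  fun _ hx c hc => hx c (hc.trans_le h)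

end BallCore

section Prokhorov

variable {X : Type*} [MetricSpace X] [MeasurableSpace X] [BorelSpace X]

theorem levyProkhorovEDist_lt_of_mem_basicBall {ι : Type} {β : ι → MeasureSpaceOn X}
    {P : MeasureSpaceOn X} {c : ι × ℕ × ℕ} (h : P ∈ basicBall β c) :
    levyProkhorovEDist (P.toMeasure : Measure X) ((β c.1).toMeasure : Measure X) <
      ENNReal.ofReal (posRat c.2) :=
  edist_lt_ofReal.2 (Metric.mem_ball.1 h)

/-- The measure of an effectively open set is lower semicomputable as a function of the measure. -/
theorem IsEffectivelyOpen.measure {π : Type*} [Primcodable π] {α : ℕ → X} {O : π → Set X}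
    (hO : IsEffectivelyOpen α O) : IsEffectivelyOpen (measurePt α) fun x : π × (ℕ × ℕ) =>
      {P : MeasureSpaceOn X | nonnegRat x.2 < (P.toMeasure : Measure X) (O x.1)} := by
  classical
  obtain ⟨E, hE, h1, h2⟩ := hO
  obtain ⟨R, hR, mR, hER⟩ := hE.exists_primrecRel
  -- The ball of radius `e` about `μ` is enumerated once the `μ`-mass of the atoms whose `e`-balls
  -- are known to lie in `O p` exceeds `q + e`; a measure within `e` of `μ` loses at most `e`.
  refine ⟨_, rePred_lt_listWeight_div hR, ?_, ?_⟩
  · rintro ⟨p, q⟩ ⟨μ, e⟩ ⟨n, hn⟩ P hP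
    have hd := levyProkhorovEDist_lt_of_mem_basicBall hP
    set J : ℕ → Prop := fun j => R (p, j, e) n with hJ
    have hS : MeasurableSet (α '' {j | J j}) := ((Set.to_countable {j | J j}).image α).measurableSet
    have hμ := right_measure_le_of_levyProkhorovEDist_lt hd hS
    rw [ENNReal.toReal_ofReal (posRat_pos e).le] at hμ
    have hsub : Metric.thickening (posRat e) (α '' {j | J j}) ⊆ O p := by
      intro x hx
      obtain ⟨_, ⟨j, hj, rfl⟩, hxj⟩ := Metric.mem_thickening_iff.1 hx
      exact h1 p (j, e) ((hER _).2 ⟨n, hj⟩) hxj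
    have hle : (listWeight J (μ.1 :: μ.2) : ℝ≥0∞) /
          (listWeight (fun _ => True) (μ.1 :: μ.2) : ℝ≥0∞) ≤
        ((measurePt α μ).toMeasure : Measure X) (α '' {j | J j}) := by
      rw [measurePt_apply]
      exact ENNReal.div_le_div_right
        (listWeight_le_listMeasure (fun i hi => Set.mem_image_of_mem _ hi) _) _
    have := hn.trans_le (hle.trans (hμ.trans (add_le_add_left (measure_mono hsub) _)))
    exact (ENNReal.add_lt_add_iff_right ENNReal.ofReal_ne_top).1 this
  · rintro ⟨p, q⟩ P hP
    -- These closed sets increase and exhaust `O p`. If `e < 1 / (n + 1)`, every atom within `e` of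
    -- `H n` has its `e`-ball enumerated.
    let H : ℕ → Set X := fun n => ballCore α (fun c => E (p, c)) (1 / ((n : ℝ) + 1))
    have hH : Monotone H := fun m n hmn => ballCore_anti _ _ (Nat.one_div_le_one_div hmn)
    have hsub : O p ⊆ ⋃ n, H n := by
      intro x hx
      obtain ⟨δ, hδ, h⟩ := h2 p x hx
      obtain ⟨n, hn⟩ := exists_nat_one_div_lt hδ
      exact Set.mem_iUnion.2 ⟨n, fun c hc => h c (hc.trans hn)⟩
    have hq : nonnegRat q < ⨆ n, (P.toMeasure : Measure X) (H n) := by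
      rw [← hH.measure_iUnion]
      exact lt_of_lt_of_le hP (measure_mono hsub)
    obtain ⟨n, hn⟩ := lt_iSup_iff.1 hq
    -- The slack is spent twice: once on passing from `P` to `μ`, once on the margin `e` in the
    -- enumerated condition.
    obtain ⟨δ, hδ, hδn⟩ : ∃ δ : ℝ, 0 < δ ∧
        nonnegRat q + ENNReal.ofReal δ + ENNReal.ofReal δ < (P.toMeasure : Measure X) (H n) := by
      obtain ⟨r, hr, hrn⟩ := ENNReal.lt_iff_exists_add_pos_lt.1 hn
      refine ⟨r / 2, by positivity, ?_⟩
      rwa [add_assoc, ← ENNReal.ofReal_add (by positivity) (by positivity), add_halves,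
        ENNReal.ofReal_coe_nnreal]
    refine ⟨min δ (1 / ((n : ℝ) + 1)), lt_min hδ (by positivity), ?_⟩
    rintro ⟨μ, e⟩ he hPμ
    have he1 : posRat e < δ := he.trans_le (min_le_left _ _)
    have he2 : posRat e < 1 / ((n : ℝ) + 1) := he.trans_le (min_le_right _ _)
    -- `μ` has finitely many atoms, so one stage confirms all of their `e`-balls that are ever
    -- enumerated.
    obtain ⟨m, hm⟩ := exists_stage_forall_mem_list
      (R := fun (x : ℕ × ℕ) k => E (p, x.1, e) → R (p, x.1, e) k)
      (fun x k l hkl h hx => mR _ _ _ hkl (h hx)) (μ.1 :: μ.2) fun x _ => by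
        by_cases hx : E (p, x.1, e)
        · exact ((hER _).1 hx).imp fun k hk _ => hk
        · exact ⟨0, fun h => absurd h hx⟩
    refine ⟨m, ?_⟩
    have hd := levyProkhorovEDist_lt_of_mem_basicBall hPμ
    have hle := left_measure_le_of_levyProkhorovEDist_lt hd
      (isClosed_ballCore α (fun c => E (p, c)) (1 / ((n : ℝ) + 1))).measurableSet
    rw [ENNReal.toReal_ofReal (posRat_pos e).le] at hle
    have hμ : ((measurePt α μ).toMeasure : Measure X) (Metric.thickening (posRat e) (H n)) ≤
        (listWeight (fun j => R (p, j, e) m) (μ.1 :: μ.2) : ℝ≥0∞) /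
          (listWeight (fun _ => True) (μ.1 :: μ.2) : ℝ≥0∞) := by
      rw [measurePt_apply]
      refine ENNReal.div_le_div_right ((listMeasure_le_listWeight (J := fun j => E (p, j, e))
        Metric.isOpen_thickening.measurableSet (fun i hi => ?_) _).trans
          (Nat.cast_le.2 (listWeight_mono hm))) _
      obtain ⟨x, hx, hix⟩ := Metric.mem_thickening_iff.1 hi
      exact hx (i, e) he2 (by rwa [basicBall, Metric.mem_ball, dist_comm])
    have h3 := hδn.trans_le (hle.trans (add_le_add_left hμ _))
    have h4 : nonnegRat q + ENNReal.ofReal (posRat e) + ENNReal.ofReal (posRat e) <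
        (listWeight (fun j => R (p, j, e) m) (μ.1 :: μ.2) : ℝ≥0∞) /
          (listWeight (fun _ => True) (μ.1 :: μ.2) : ℝ≥0∞) + ENNReal.ofReal (posRat e) :=
      lt_of_le_of_lt (by gcongr) h3
    exact (ENNReal.add_lt_add_iff_right ENNReal.ofReal_ne_top).1 h4

end Prokhorov

/-! ### Density of the finitely supported rational measures. -/

section Density

theorem listWeight_map_range (J : ℕ → Prop) [DecidablePred J] (w : ℕ → ℕ) (n : ℕ) :
    listWeight J ((List.range n).map fun i => (i, w i)) =
      ∑ i ∈ Finset.range n with J i, (w i + 1) := by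
  rw [Finset.sum_filter]
  induction n with
  | zero => simp [listWeight]
  | succ n ih =>
    rw [Finset.sum_range_succ, ← ih, List.range_succ, List.map_append]
    simp only [listWeight, List.map_append, List.sum_append]
    simp

variable {X : Type*} [MetricSpace X] [MeasurableSpace X] [BorelSpace X]

theorem exists_measure_compl_iUnion_ball_lt {α : ℕ → X} (hα : DenseRange α) (P : Measure X)
    [IsProbabilityMeasure P] {δ : ℝ} (hδ : 0 < δ) :
    ∃ n : ℕ, P.real (⋃ i ∈ Finset.range (n + 1), Metric.ball (α i) δ)ᶜ < δ := by
  have huniv : (⋃ i, Metric.ball (α i) δ) = Set.univ := by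
    refine Set.eq_univ_of_forall fun x => ?_
    obtain ⟨i, hi⟩ := hα.exists_dist_lt x hδ
    exact Set.mem_iUnion.2 ⟨i, hi⟩
  have h : Filter.Tendsto (fun n => P (⋃ i ≤ n, Metric.ball (α i) δ)) Filter.atTop
      (nhds (P (⋃ i, Metric.ball (α i) δ))) := by
    simpa [Set.accumulate_def] using
      tendsto_measure_iUnion_accumulate (μ := P) (f := fun i => Metric.ball (α i) δ)
  rw [huniv, measure_univ] at h
  obtain ⟨n, hn⟩ := (((ENNReal.tendsto_toReal ENNReal.one_ne_top).comp h).eventually_const_lt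
    (show 1 - δ < (1 : ℝ≥0∞).toReal by simpa using hδ)).exists
  refine ⟨n, ?_⟩
  have hn' : 1 - δ < P.real (⋃ i ∈ Finset.range (n + 1), Metric.ball (α i) δ) := by
    simpa [Nat.lt_succ_iff, Measure.real] using hn
  rw [probReal_compl_eq_one_sub (Finset.measurableSet_biUnion _ fun i _ =>
    Metric.isOpen_ball.measurableSet)]
  linarith

/-- This bounds the rounding cost: the weights sum to at most `N + m` instead of `N`. -/
theorem mul_sub_div_le {N m x : ℝ} (hN : 0 < N) (hm : 0 ≤ m) (hx : x ≤ 1) :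
    x - m / N ≤ N * x / (N + m) := by
  rw [le_div_iff₀ (by positivity), sub_mul, div_mul_eq_mul_div, sub_le_iff_le_add,
    ← sub_le_iff_le_add', le_div_iff₀ hN]
  nlinarith [mul_nonneg hm hm, mul_nonneg hN.le hm]

/-- The measures concentrated on finite subsets of a dense set, with rational values, are dense in
the Prokhorov metric. -/
theorem denseRange_measurePt {α : ℕ → X} (hα : DenseRange α) : DenseRange (measurePt α) := by
  classical
  refine Metric.denseRange_iff.2 fun P r hr => ?_
  set δ := r / 4 with hδ_def
  have hδ : 0 < δ := by positivity
  obtain ⟨n, hn⟩ := exists_measure_compl_iUnion_ball_lt hα (P.toMeasure : Measure X) hδ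
  -- Making the balls disjoint assigns each cell's mass to its center; the mass is then rounded to a
  -- multiple of `1 / N`.
  set p : ℕ → ℝ := fun i =>
    (P.toMeasure : Measure X).real (disjointed (fun i => Metric.ball (α i) δ) i) with hp
  obtain ⟨N, hN⟩ := exists_nat_gt (((n : ℝ) + 1) / δ)
  have hN0 : (0 : ℝ) < N := lt_trans (by positivity) hN
  have hNδ : ((n : ℝ) + 1) / N < δ := by
    rwa [div_lt_iff₀ hN0, mul_comm, ← div_lt_iff₀ hδ]
  -- A code `w` means weight `w + 1`, so the floor rounds up: each weight is at least `N * p i` and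
  -- at most `N * p i + 1`.
  set w : ℕ → ℕ := fun i => ⌊N * p i⌋₊ with hw
  let c : (ℕ × ℕ) × List (ℕ × ℕ) :=
    ((0, w 0), (List.range n).map fun i => (i + 1, w (i + 1)))
  have hc : c.1 :: c.2 = (List.range (n + 1)).map fun i => (i, w i) := by
    simp [c, List.range_succ_eq_map, Function.comp_def]
  have hdisj := disjoint_disjointed fun i => Metric.ball (α i) δ
  have hmeas : ∀ i, MeasurableSet (disjointed (fun i => Metric.ball (α i) δ) i) := fun i =>
    MeasurableSet.disjointed (fun i => Metric.isOpen_ball.measurableSet) i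
  have hsum : ∀ s : Finset ℕ, ∑ i ∈ s, p i ≤ 1 := fun s => by
    rw [hp, ← measureReal_biUnion_finset (fun i _ j _ hij => hdisj hij) fun i _ => hmeas i]
    exact measureReal_le_one
  have hdist : dist P (measurePt α c) = levyProkhorovDist (P.toMeasure : Measure X)
      ((measurePt α c).toMeasure : Measure X) := rfl
  refine ⟨c, lt_of_le_of_lt (b := 2 * δ) ?_ (by rw [hδ_def]; linarith)⟩
  rw [hdist]
  -- For probability measures one of the two Prokhorov inequalities suffices. One `δ` pays for the
  -- mass outside the balls, the other for rounding.
  refine levyProkhorovDist_le_of_forall_le _ _ (by positivity) fun ε B hε hB => ?_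
  set J : ℕ → Prop := fun i => α i ∈ Metric.thickening ε B with hJ
  set s := (Finset.range (n + 1)).filter J with hs
  have h1 : (P.toMeasure : Measure X).real B ≤ ∑ i ∈ s, p i + δ := by
    have hsub : B ⊆ (⋃ i ∈ s, disjointed (fun i => Metric.ball (α i) δ) i) ∪
        (⋃ i ∈ Finset.range (n + 1), Metric.ball (α i) δ)ᶜ := by
      intro x hx
      by_cases hxn : x ∈ ⋃ i ∈ Finset.range (n + 1), Metric.ball (α i) δ
      · left
        simp only [Set.mem_iUnion, exists_prop] at hxn
        obtain ⟨i, hi, hxi⟩ := hxn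
        obtain ⟨j, hj⟩ := Set.mem_iUnion.1 ((iUnion_disjointed (f := fun i =>
          Metric.ball (α i) δ)).symm ▸ Set.mem_iUnion.2 ⟨i, hxi⟩ :
            x ∈ ⋃ j, disjointed (fun i => Metric.ball (α i) δ) j)
        have hji : j ≤ i := by
          by_contra! hij
          exact (disjointed_apply (fun i => Metric.ball (α i) δ) j ▸ hj).2
            (Finset.le_sup (f := fun i => Metric.ball (α i) δ) (Finset.mem_Iio.2 hij) hxi)
        have hxj : dist x (α j) < δ := disjointed_subset (fun i => Metric.ball (α i) δ) j hj
        refine Set.mem_iUnion₂.2 ⟨j, Finset.mem_filter.2 ⟨Finset.mem_range.2 ?_, ?_⟩, hj⟩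
        · exact hji.trans_lt (Finset.mem_range.1 hi)
        · exact Metric.mem_thickening_iff.2 ⟨x, hx, by rw [dist_comm]; linarith⟩
      · exact Or.inr hxn
    refine (measureReal_mono hsub).trans ((measureReal_union_le _ _).trans (add_le_add ?_ hn.le))
    exact measureReal_biUnion_finset_le _ _
  have h2 : (N : ℝ) * ∑ i ∈ s, p i ≤ listWeight J (c.1 :: c.2) := by
    rw [hc, listWeight_map_range, Finset.mul_sum, Nat.cast_sum]
    refine Finset.sum_le_sum fun i _ => ?_
    rw [Nat.cast_add_one]
    exact (Nat.lt_floor_add_one _).le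
  have h3 : (listWeight (fun _ => True) (c.1 :: c.2) : ℝ) ≤ N + (n + 1) := by
    rw [hc, listWeight_map_range, Finset.filter_true, Nat.cast_sum]
    calc ∑ i ∈ Finset.range (n + 1), ((w i + 1 : ℕ) : ℝ)
        ≤ ∑ i ∈ Finset.range (n + 1), (N * p i + 1) := by
          refine Finset.sum_le_sum fun i _ => ?_
          rw [Nat.cast_add_one]
          exact add_le_add_left (Nat.floor_le (mul_nonneg hN0.le measureReal_nonneg)) 1
      _ ≤ N + (n + 1) := by
          rw [Finset.sum_add_distrib, ← Finset.mul_sum]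
          simp only [Finset.sum_const, Finset.card_range, nsmul_eq_mul, mul_one, Nat.cast_add_one]
          exact add_le_add_left (mul_le_of_le_one_right hN0.le (hsum _)) _
  have hWpos : (0 : ℝ) < listWeight (fun _ => True) (c.1 :: c.2) := by
    exact_mod_cast listWeight_true_pos c.1 c.2
  have h4 : (P.toMeasure : Measure X).real B ≤
      (listWeight J (c.1 :: c.2) : ℝ) / listWeight (fun _ => True) (c.1 :: c.2) + 2 * δ := by
    have h5 := mul_sub_div_le (m := (n : ℝ) + 1) hN0 (by positivity) (hsum s)
    have h6 : (N * ∑ i ∈ s, p i) / (N + ((n : ℝ) + 1)) ≤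
        (listWeight J (c.1 :: c.2) : ℝ) / listWeight (fun _ => True) (c.1 :: c.2) :=
      div_le_div₀ (Nat.cast_nonneg _) h2 hWpos h3
    linarith
  have h7 : ENNReal.ofReal
      ((listWeight J (c.1 :: c.2) : ℝ) / listWeight (fun _ => True) (c.1 :: c.2)) ≤
      ((measurePt α c).toMeasure : Measure X) (Metric.thickening ε B) := by
    rw [measurePt_apply, ENNReal.ofReal_div_of_pos hWpos, ENNReal.ofReal_natCast,
      ENNReal.ofReal_natCast]
    exact ENNReal.div_le_div_right (listWeight_le_listMeasure (fun i hi => hi) _) _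
  rw [← ofReal_measureReal]
  refine (ENNReal.ofReal_le_ofReal (h4.trans (add_le_add_right hε.le _))).trans ?_
  rw [ENNReal.ofReal_add (by positivity) (by linarith)]
  exact add_le_add_left h7 _

end Density

/-! ### Rational thresholds and elementary probability estimates. -/

theorem exists_nonnegRat_between {x y : ℝ≥0∞} (h : x < y) :
    ∃ q : ℕ × ℕ, x < nonnegRat q ∧ nonnegRat q < y := by
  obtain ⟨q, hq, h1, h2⟩ := ENNReal.lt_iff_exists_rat_btwn.1 h
  have : nonnegRat (q.num.toNat, q.den - 1) = ((q : ℝ).toNNReal : ℝ≥0∞) := by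
    have hd : ((q.den - 1 : ℕ) : ℝ≥0∞) + 1 = (q.den : ℝ≥0∞) := by
      rw [← Nat.cast_add_one, Nat.sub_add_cancel q.den_pos]
    have hn : ((q.num.toNat : ℕ) : ℝ) = (q.num : ℝ) := by
      exact_mod_cast Int.toNat_of_nonneg (Rat.num_nonneg.2 hq)
    have hden : (0 : ℝ) < q.den := by exact_mod_cast q.den_pos
    rw [nonnegRat, hd, ← ENNReal.ofReal, Rat.cast_def, ← hn, ENNReal.ofReal_div_of_pos hden]
    simp
  exact ⟨_, this ▸ h1, this ▸ h2⟩

theorem nonnegRat_lt_natCast_iff (r : ℕ × ℕ) (k : ℕ) :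
    nonnegRat r < (k : ℝ≥0∞) ↔ r.1 < k * (r.2 + 1) := by
  rw [nonnegRat, ENNReal.div_lt_iff (by simp) (by simp)]
  exact_mod_cast Iff.rfl

/-- The codes `(b, b)` serve as the thresholds for "almost full" measure. -/
theorem nonnegRat_self (b : ℕ) : nonnegRat (b, b) = 1 - ((b : ℝ≥0∞) + 1)⁻¹ := by
  have h : nonnegRat (b, b) + ((b : ℝ≥0∞) + 1)⁻¹ = 1 := by
    rw [nonnegRat, ← one_div, ← ENNReal.add_div]
    exact ENNReal.div_self (by simp) (by finiteness)
  exact ENNReal.eq_sub_of_add_eq (by simp) h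

theorem one_sub_lt_one_sub {x y : ℝ≥0∞} (hy : y ≤ 1) (h : x < y) : 1 - y < 1 - x :=
  (ENNReal.cancel_of_ne (by finiteness)).tsub_lt_tsub_left_of_le hy h

section Probability

variable {X : Type*} [MeasurableSpace X] (P : Measure X) [IsProbabilityMeasure P]

theorem measure_le_of_nonnegRat_lt {U V : Set X} (hV : MeasurableSet V) (h : U ⊆ Vᶜ) {b : ℕ}
    (hb : nonnegRat (b, b) < P V) : P U ≤ ((b : ℝ≥0∞) + 1)⁻¹ := by
  refine (measure_mono h).trans ?_
  rw [prob_compl_eq_one_sub hV]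
  rw [nonnegRat_self] at hb
  exact tsub_le_iff_tsub_le.1 hb.le

/-- The bound uses `b + 2` rather than `b + 1` to make the conclusion strict. -/
theorem nonnegRat_lt_measure {U V : Set X} (h : U ∪ V = Set.univ) {b : ℕ}
    (hb : P U ≤ ((b : ℝ≥0∞) + 2)⁻¹) : nonnegRat (b, b) < P V := by
  have h1 : 1 - P U ≤ P V := by
    rw [tsub_le_iff_left, ← measure_univ (μ := P), ← h]
    exact measure_union_le _ _
  refine lt_of_lt_of_le ?_ h1
  rw [nonnegRat_self]
  refine one_sub_lt_one_sub ?_ (hb.trans_lt (ENNReal.inv_lt_inv.2 ?_))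
  · rw [ENNReal.inv_le_one]
    exact le_add_self
  · exact (ENNReal.add_lt_add_iff_left (by simp)).2 (by norm_num)

end Probability

/-- A tube lemma argument. Lower semicontinuity of the separator enters the proof only here. -/
theorem isOpen_setOf_forall_lt {Y Z : Type*} [TopologicalSpace Y] [TopologicalSpace Z]
    {s : Y × Z → ℝ≥0∞} (hs : LowerSemicontinuous s) {K : Set Z} (hK : IsCompact K) (r : ℝ≥0∞) :
    IsOpen {x | ∀ P ∈ K, r < s (x, P)} := by
  refine isOpen_iff_mem_nhds.2 fun x hx => ?_
  refine hK.eventually_forall_of_forall_eventually fun P hP => ?_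
  exact (hs.isOpen_preimage r).mem_nhds (hx P hP)

theorem measure_le_inv_of_forall_lt {X : Type*} [MeasurableSpace X]
    {s : X × MeasureSpaceOn X → ℝ≥0∞} (hs : HasMeanAtMostOne s)
    {P : MeasureSpaceOn X} {U : Set X} (hU : MeasurableSet U) {r : ℝ≥0∞}
    (h : ∀ x ∈ U, r ≤ s (x, P)) : (P.toMeasure : Measure X) U ≤ r⁻¹ := by
  rw [ENNReal.le_inv_iff_mul_le, mul_comm, ← lintegral_indicator_const hU]
  refine le_trans (lintegral_mono fun x => ?_) (hs P)
  by_cases hx : x ∈ U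
  · simpa [hx] using h x hx
  · simp [hx]

/-! ### Approximating an open set from inside by finite unions of balls. -/

section InnerLists

variable {X : Type*} [MetricSpace X]

/-- The lists of basic balls whose doubles have closures inside a given set. -/
def IsInnerList (α : ℕ → X) (U : Set X) (L : List (ℕ × ℕ × ℕ)) : Prop :=
  ∀ c ∈ L, Metric.closedBall (α c.1) (2 * posRat c.2) ⊆ U

theorem IsInnerList.ballUnion_doubleRadii_subset {α : ℕ → X} {U : Set X} {L : List (ℕ × ℕ × ℕ)}
    (h : IsInnerList α U L) : ballUnion α (doubleRadii L) ⊆ U := by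
  intro x hx
  obtain ⟨c, hc, hxc⟩ := mem_ballUnion_doubleRadii.1 hx
  exact h c hc hxc.le

theorem IsInnerList.union_closedBallUnionCompl {α : ℕ → X} {U : Set X} {L : List (ℕ × ℕ × ℕ)}
    (h : IsInnerList α U L) : U ∪ closedBallUnionCompl α (doubleRadii L) = Set.univ := by
  refine Set.eq_univ_of_forall fun x => or_iff_not_imp_left.2 fun hx => ?_
  refine mem_closedBallUnionCompl_doubleRadii.2 fun c hc => ?_
  by_contra! hxc
  exact hx (h c hc hxc)

theorem directed_ballUnion (α : ℕ → X) (U : Set X) :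
    Directed (· ⊆ ·) fun L : {L // IsInnerList α U L} => ballUnion α L.1 := by
  intro L L'
  refine ⟨⟨L.1 ++ L'.1, fun c hc => ?_⟩, fun x hx => ?_, fun x hx => ?_⟩
  · exact (List.mem_append.1 hc).elim (L.2 c) (L'.2 c)
  · obtain ⟨c, hc, h⟩ := mem_ballUnion.1 hx
    exact mem_ballUnion.2 ⟨c, List.mem_append_left _ hc, h⟩
  · obtain ⟨c, hc, h⟩ := mem_ballUnion.1 hx
    exact mem_ballUnion.2 ⟨c, List.mem_append_right _ hc, h⟩

theorem iUnion_ballUnion_inner {α : ℕ → X} (hα : DenseRange α) {U : Set X} (hU : IsOpen U) :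
    U ⊆ ⋃ L : {L // IsInnerList α U L}, ballUnion α L.1 := by
  intro x hx
  obtain ⟨δ, hδ, hxU⟩ := Metric.isOpen_iff.1 hU x hx
  obtain ⟨q, hq⟩ := exists_posRat_lt (show 0 < δ / 3 by positivity)
  obtain ⟨i, hi⟩ := hα.exists_dist_lt x (posRat_pos q)
  refine Set.mem_iUnion.2 ⟨⟨[(i, q)], fun c hc y hy => hxU ?_⟩,
    mem_ballUnion.2 ⟨(i, q), by simp, hi⟩⟩
  obtain rfl := List.mem_singleton.1 hc
  have hy' : dist y (α i) ≤ 2 * posRat q := hy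
  exact Metric.mem_ball.2 (by linarith [dist_triangle_right y x (α i)])

theorem exists_isInnerList_lt_measure [MeasurableSpace X] {α : ℕ → X} (hα : DenseRange α)
    {U : Set X} (hU : IsOpen U) (P : Measure X) {r : ℝ≥0∞} (hr : r < P U) :
    ∃ L, IsInnerList α U L ∧ r < P (ballUnion α L) := by
  have h := hr.trans_le (measure_mono (iUnion_ballUnion_inner hα hU))
  rw [(directed_ballUnion α U).measure_iUnion] at h
  obtain ⟨L, hL⟩ := lt_iSup_iff.1 h
  exact ⟨L.1, L.2, hL⟩

end InnerLists

/-! ### Construction of uniform tests and of separating lists of balls. -/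

section Tests

variable {X : Type*} [MetricSpace X] [MeasurableSpace X] [BorelSpace X]

theorem denseRange_prodPt {α : ℕ → X} (hα : DenseRange α) : DenseRange (prodPt α) :=
  hα.prodMap (denseRange_measurePt hα)

theorem rePred_nonnegRat_lt_natCast :
    REPred fun x : (ℕ × ℕ) × ℕ => nonnegRat x.1 < (x.2 : ℝ≥0∞) := by
  have h : PrimrecPred fun x : (ℕ × ℕ) × ℕ => x.1.1 < x.2 * (x.1.2 + 1) :=
    Primrec.nat_lt.comp (Primrec.fst.comp Primrec.fst)
      (Primrec.nat_mul.comp Primrec.snd (Primrec.succ.comp (Primrec.snd.comp Primrec.fst)))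
  exact h.rePred.of_eq fun x => (nonnegRat_lt_natCast_iff _ _).symm

/-- An effectively open sequence of sets whose sections have rapidly decreasing measures gives rise
to a uniform test. -/
theorem exists_isUniformTest (S : ConstructiveMetricSpace X) {O : ℕ → Set (X × MeasureSpaceOn X)}
    (hO : IsEffectivelyOpen (prodPt S.pt) O)
    (hP : ∀ k (P : MeasureSpaceOn X),
      (P.toMeasure : Measure X) {x | (x, P) ∈ O k} ≤ (2⁻¹ : ℝ≥0∞) ^ (2 * k + 2)) :
    ∃ t, IsUniformTest S t ∧ ∀ z, (∃ᶠ k in Filter.atTop, z ∈ O k) → t z = ∞ := by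
  classical
  have hdense := denseRange_prodPt S.denseRange_pt
  have hopen := hO.isOpen hdense
  obtain ⟨E, hE, hOE⟩ := hO.exists_eq_iUnion hdense
  -- With `k ≤ 2 ^ (k + 1)` and sections of measure at most `2⁻¹ ^ (2 * k + 2)`, the integral is at
  -- most `∑ 2⁻¹ ^ (k + 1) = 1`.
  refine ⟨fun z => ⨆ k : ℕ, (O k).indicator (fun _ => (k : ℝ≥0∞)) z, ⟨?_, ?_⟩, ?_⟩
  · refine ⟨fun x => ∃ k : ℕ, nonnegRat x.1 < (k : ℝ≥0∞) ∧ E (k, x.2), ?_, ?_⟩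
    · have h1 : Computable fun x : ((ℕ × ℕ) × (ℕ × ((ℕ × ℕ) × List (ℕ × ℕ))) × ℕ × ℕ) × ℕ =>
          (x.1.1, x.2) := (Primrec.pair (Primrec.fst.comp Primrec.fst) Primrec.snd).to_comp
      have h2 : Computable fun x : ((ℕ × ℕ) × (ℕ × ((ℕ × ℕ) × List (ℕ × ℕ))) × ℕ × ℕ) × ℕ =>
          (x.2, x.1.2) := (Primrec.pair Primrec.snd (Primrec.snd.comp Primrec.fst)).to_comp
      exact ((rePred_nonnegRat_lt_natCast.comp h1).and (hE.comp h2)).exists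
    · intro r
      ext z
      have h1 : nonnegRat r < ⨆ k : ℕ, (O k).indicator (fun _ => (k : ℝ≥0∞)) z ↔
          ∃ k : ℕ, nonnegRat r < (k : ℝ≥0∞) ∧ z ∈ O k := by
        rw [lt_iSup_iff]
        refine exists_congr fun k => ?_
        by_cases hz : z ∈ O k <;> simp [hz]
      rw [Set.mem_ofPred_eq, h1]
      simp only [hOE, Set.mem_iUnion, exists_prop]
      exact ⟨fun ⟨k, hk, c, hc, hz⟩ => ⟨c, ⟨k, hk, hc⟩, hz⟩,
        fun ⟨c, ⟨k, hk, hc⟩, hz⟩ => ⟨k, hk, c, hc, hz⟩⟩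
  · intro P
    have hsec : ∀ k, MeasurableSet {x | (x, P) ∈ O k} := fun k =>
      ((hopen k).preimage (Continuous.prodMk_left P)).measurableSet
    calc ∫⁻ x, ⨆ k : ℕ, (O k).indicator (fun _ => (k : ℝ≥0∞)) (x, P) ∂(P.toMeasure : Measure X)
        ≤ ∫⁻ x, ∑' k : ℕ, {x | (x, P) ∈ O k}.indicator (fun _ => (k : ℝ≥0∞)) x
            ∂(P.toMeasure : Measure X) :=
          lintegral_mono fun x => iSup_le fun k =>
            ENNReal.le_tsum (f := fun k : ℕ =>
              {x | (x, P) ∈ O k}.indicator (fun _ => (k : ℝ≥0∞)) x) k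
      _ = ∑' k : ℕ, (k : ℝ≥0∞) * (P.toMeasure : Measure X) {x | (x, P) ∈ O k} := by
          rw [lintegral_tsum fun k => (measurable_const.indicator (hsec k)).aemeasurable]
          simp only [lintegral_indicator_const (hsec _)]
      _ ≤ ∑' k : ℕ, (2⁻¹ : ℝ≥0∞) ^ (k + 1) := by
          refine ENNReal.tsum_le_tsum fun k => ?_
          have hk : (k : ℝ≥0∞) ≤ 2 ^ (k + 1) := by
            have := (Nat.lt_two_pow_self (n := k)).trans (Nat.pow_lt_pow_succ one_lt_two)
            exact_mod_cast this.le
          refine (mul_le_mul' hk (hP k P)).trans (le_of_eq ?_)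
          rw [show 2 * k + 2 = (k + 1) + (k + 1) by ring, pow_add 2⁻¹, ← mul_assoc, ← mul_pow,
            ENNReal.mul_inv_cancel two_ne_zero ENNReal.ofNat_ne_top, one_pow, one_mul]
      _ ≤ 1 := by
          rw [ENNReal.tsum_geometric_add_one, ENNReal.one_sub_inv_two, inv_inv,
            ENNReal.inv_mul_cancel two_ne_zero ENNReal.ofNat_ne_top]
  · intro z hz
    refine ENNReal.eq_top_of_forall_nnreal_le fun r => ?_
    obtain ⟨n, hn⟩ := exists_nat_ge r
    obtain ⟨k, hk, hzk⟩ := Filter.frequently_atTop.1 hz n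
    refine le_iSup_of_le k ?_
    rw [Set.indicator_of_mem hzk]
    exact_mod_cast hn.trans (Nat.cast_le.2 hk)

/-- A Dini-type argument: the conditions on the measure are open and directed in the list, so on a
compact set one list serves all measures. -/
theorem exists_isInnerList_forall_lt_measure (S : ConstructiveMetricSpace X) {U : Set X}
    (hU : IsOpen U) {K : Set (MeasureSpaceOn X)} (hK : IsCompact K) {q : ℕ × ℕ}
    (h : ∀ P ∈ K, nonnegRat q < (P.toMeasure : Measure X) U) :
    ∃ L, IsInnerList S.pt U L ∧
      ∀ P ∈ K, nonnegRat q < (P.toMeasure : Measure X) (ballUnion S.pt L) := by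
  have hopen : ∀ L : {L // IsInnerList S.pt U L}, IsOpen {P : MeasureSpaceOn X |
      nonnegRat q < (P.toMeasure : Measure X) (ballUnion S.pt L.1)} := fun L =>
    (isEffectivelyOpen_ballUnion S).measure.isOpen (denseRange_measurePt S.denseRange_pt)
      (L.1, q)
  have : Nonempty {L // IsInnerList S.pt U L} := ⟨⟨[], fun c hc => by simp at hc⟩⟩
  obtain ⟨L, hL⟩ := hK.elim_directed_cover _ hopen (fun P hP => by
    obtain ⟨L, hL, hP⟩ := exists_isInnerList_lt_measure S.denseRange_pt hU _ (h P hP)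
    exact Set.mem_iUnion.2 ⟨⟨L, hL⟩, hP⟩) (Directed.mono_comp (· ⊆ ·)
      (g := fun V => {P : MeasureSpaceOn X | nonnegRat q < (P.toMeasure : Measure X) V})
      (fun V V' hV P hP => lt_of_lt_of_le hP (measure_mono hV)) (directed_ballUnion S.pt U))
  exact ⟨L.1, L.2, hL⟩

theorem exists_isOpen_measure_ne {P Q : MeasureSpaceOn X} (h : P ≠ Q) :
    ∃ U, IsOpen U ∧ (P.toMeasure : Measure X) U ≠ (Q.toMeasure : Measure X) U := by
  by_contra! H
  refine h (LevyProkhorov.toMeasure_injective (ProbabilityMeasure.toMeasure_injective ?_))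
  refine ext_of_generate_finite _ (BorelSpace.measurable_eq (α := X)) isPiSystem_isOpen
    (fun U hU => H U hU) (H _ isOpen_univ)

/-- Two different measures are separated by effectively open sets which cover the space of
measures. -/
theorem exists_separating_ballList {α : ℕ → X} (hα : DenseRange α) {P Q : MeasureSpaceOn X}
    {U : Set X} (hU : IsOpen U) (h : (Q.toMeasure : Measure X) U < (P.toMeasure : Measure X) U) :
    ∃ (L : List (ℕ × ℕ × ℕ)) (a b : ℕ × ℕ),
      ¬nonnegRat a < (P.toMeasure : Measure X) (closedBallUnionCompl α L) ∧
      ¬nonnegRat b < (Q.toMeasure : Measure X) (ballUnion α (doubleRadii L)) ∧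
      ∀ R : MeasureSpaceOn X, nonnegRat a < (R.toMeasure : Measure X) (closedBallUnionCompl α L) ∨
        nonnegRat b < (R.toMeasure : Measure X) (ballUnion α (doubleRadii L)) := by
  obtain ⟨b, hQb, hbP⟩ := exists_nonnegRat_between h
  obtain ⟨L, hL, hbL⟩ := exists_isInnerList_lt_measure hα hU _ hbP
  -- This leaves room for a threshold `a` with `a + b < 1`. A measure exceeding neither threshold
  -- would then have total mass below one.
  have hPN : (P.toMeasure : Measure X) (closedBallUnionCompl α L) < 1 - nonnegRat b := by
    refine (measure_mono (closedBallUnionCompl_subset_compl α L)).trans_lt ?_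
    rw [prob_compl_eq_one_sub (isOpen_ballUnion α L).measurableSet]
    exact one_sub_lt_one_sub prob_le_one hbL
  obtain ⟨a, hPa, hab⟩ := exists_nonnegRat_between hPN
  refine ⟨L, a, b, hPa.not_gt,
    ((measure_mono hL.ballUnion_doubleRadii_subset).trans_lt hQb).not_gt, fun R => ?_⟩
  by_contra! hR
  refine (lt_tsub_iff_right.1 hab).not_ge ?_
  calc (1 : ℝ≥0∞) = (R.toMeasure : Measure X) Set.univ := measure_univ.symm
    _ ≤ (R.toMeasure : Measure X)
        (closedBallUnionCompl α L ∪ ballUnion α (doubleRadii L)) :=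
      measure_mono fun x _ => mem_closedBallUnionCompl_or_mem_ballUnion α L x
    _ ≤ nonnegRat a + nonnegRat b := (measure_union_le _ _).trans (add_le_add hR.1 hR.2)

end Tests

theorem computable_two_pow_two_mul_add_two : Computable fun k : ℕ => 2 ^ (2 * k + 2) :=
  (primrec_two_pow.comp (Primrec.succ.comp (Primrec.succ.comp
    (Primrec.nat_mul.comp (Primrec.const 2) Primrec.id)))).to_comp

/-! ### From the separator to tests, and the theorem. -/

section Orthogonality

variable {X : Type*} [MetricSpace X] [MeasurableSpace X] [BorelSpace X]

/-- A lower semicontinuous function with mean at most one which separates two compact classes of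
measures yields finite unions of balls which are almost full for all measures in the first class
and almost null for all measures in the second one. -/
theorem exists_ballList_of_separator (S : ConstructiveMetricSpace X)
    {K₁ K₂ : Set (MeasureSpaceOn X)} (hK₁ : IsCompact K₁) (hK₂ : IsCompact K₂)
    {s : X × MeasureSpaceOn X → ℝ≥0∞} (hs : LowerSemicontinuous s) (hmean : HasMeanAtMostOne s)
    (hsep : ∀ P ∈ K₁, ∀ Q ∈ K₂, ∀ x, s (x, P) = ∞ ∨ s (x, Q) = ∞) (b : ℕ) :
    ∃ L, (∀ P ∈ K₁, nonnegRat (b, b) < (P.toMeasure : Measure X) (ballUnion S.pt L)) ∧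
      ∀ Q ∈ K₂, nonnegRat (b, b) <
        (Q.toMeasure : Measure X) (closedBallUnionCompl S.pt (doubleRadii L)) := by
  have hr : ((b : ℝ≥0∞) + 2) < ∞ := by finiteness
  have hU₁ := isOpen_setOf_forall_lt hs hK₁ ((b : ℝ≥0∞) + 2)
  have hU₂ := isOpen_setOf_forall_lt hs hK₂ ((b : ℝ≥0∞) + 2)
  have hunion : {x | ∀ P ∈ K₁, (b : ℝ≥0∞) + 2 < s (x, P)} ∪
      {x | ∀ Q ∈ K₂, (b : ℝ≥0∞) + 2 < s (x, Q)} = Set.univ := by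
    refine Set.eq_univ_of_forall fun x => or_iff_not_imp_left.2 fun hx Q hQ => ?_
    simp only [Set.mem_ofPred_eq, not_forall] at hx
    obtain ⟨P, hP, hxP⟩ := hx
    rcases hsep P hP Q hQ x with h | h
    · exact absurd (h ▸ hr) hxP
    · exact h ▸ hr
  -- The sets cross over: the first is small for `K₁`, so the second is almost full for `K₁`, yet
  -- small for `K₂`.
  obtain ⟨L, hL, hPL⟩ := exists_isInnerList_forall_lt_measure S hU₂ hK₁ (q := (b, b))
    fun P hP => nonnegRat_lt_measure _ hunion
      (measure_le_inv_of_forall_lt hmean hU₁.measurableSet fun x hx => (hx P hP).le)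
  exact ⟨L, hPL, fun Q hQ => nonnegRat_lt_measure _ hL.union_closedBallUnionCompl
    (measure_le_inv_of_forall_lt hmean hU₂.measurableSet fun x hx => (hx Q hQ).le)⟩

/-- For `D` the first set, `C` lies in this union exactly when all measures in `C \ D` pass the
second threshold; this makes the condition on the list enumerable. -/
theorem isEffectivelyOpen_thresholds {α : ℕ → X}
    {V W : List (ℕ × ℕ × ℕ) → Set X} (hV : IsEffectivelyOpen α V) (hW : IsEffectivelyOpen α W)
    {f : ℕ → ℕ} (hf : Computable f) (L₀ : List (ℕ × ℕ × ℕ)) (a : ℕ × ℕ) :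
    IsEffectivelyOpen (measurePt α) fun p : ℕ × List (ℕ × ℕ × ℕ) =>
      {P : MeasureSpaceOn X | nonnegRat a < (P.toMeasure : Measure X) (V L₀)} ∪
        {P : MeasureSpaceOn X | nonnegRat (f p.1, f p.1) < (P.toMeasure : Measure X) (W p.2)} := by
  have hf' : Computable fun p : ℕ × List (ℕ × ℕ × ℕ) => f p.1 := hf.comp Computable.fst
  exact (hV.measure.comp (Computable.const (L₀, a))).union
    (hW.measure.comp (Computable.pair Computable.snd (Computable.pair hf' hf')))

/-- Sets which are null up to `2⁻¹ ^ (2 * k + 2)` for all measures for which given disjoint sets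
have measure almost one provide a uniform test. -/
theorem exists_isUniformTest_of_disjoint (S : ConstructiveMetricSpace X) {V W : ℕ → Set X}
    (hV : IsEffectivelyOpen S.pt V) (hW : IsEffectivelyOpen S.pt W) (hVW : ∀ k, V k ⊆ (W k)ᶜ) :
    ∃ t, IsUniformTest S t ∧ ∀ x (P : MeasureSpaceOn X),
      (∀ k, nonnegRat (2 ^ (2 * k + 2), 2 ^ (2 * k + 2)) < (P.toMeasure : Measure X) (W k)) →
      (∃ᶠ k in Filter.atTop, x ∈ V k) → t (x, P) = ∞ := by
  have hf := computable_two_pow_two_mul_add_two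
  -- Restricting to measures for which `W k` is almost full enforces the bound for all measures:
  -- elsewhere the section is empty.
  obtain ⟨t, ht, htop⟩ := exists_isUniformTest S (hV.prod (hW.measure.comp
    (Computable.pair Computable.id (Computable.pair hf hf)))) fun k P => by
      by_cases hP : nonnegRat (2 ^ (2 * k + 2), 2 ^ (2 * k + 2)) <
          (P.toMeasure : Measure X) (W k)
      · refine (measure_le_of_nonnegRat_lt _ (hW.isOpen S.denseRange_pt k).measurableSet
          (fun x hx => hVW k hx.1) hP).trans ?_
        rw [← ENNReal.inv_pow, ENNReal.inv_le_inv]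
        push_cast
        exact le_self_add
      · refine le_of_eq_of_le ?_ zero_le
        refine measure_mono_null (t := ∅) (fun x hx => hP hx.2) measure_empty
  exact ⟨t, ht, fun x P hP hx => htop _ (hx.mono fun k hk => ⟨hk, hP k⟩)⟩

theorem disjoint_randoms_of_measure_lt (S : ConstructiveMetricSpace X) {C : Set (MeasureSpaceOn X)}
    (hC : IsEffectivelyCompact (measurePt S.pt) C) {s : X × MeasureSpaceOn X → ℝ≥0∞}
    (hs : LowerSemicontinuous s) (hsC : IsSeparator C s) {P Q : MeasureSpaceOn X} (hP : P ∈ C)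
    (hQ : Q ∈ C) {U : Set X} (hU : IsOpen U)
    (h : (Q.toMeasure : Measure X) U < (P.toMeasure : Measure X) U) :
    randoms S P ∩ randoms S Q = ∅ := by
  obtain ⟨-, hmean, hsep⟩ := hsC
  have hα := S.denseRange_pt
  have hβ := denseRange_measurePt hα
  have hG := isEffectivelyOpen_ballUnion S
  have hN := isEffectivelyOpen_closedBallUnionCompl S
  have hdbl := primrec_doubleRadii.to_comp
  have hG' := hG.comp hdbl
  have hN' := hN.comp hdbl
  obtain ⟨L₀, a, b, hPa, hQb, hab⟩ := exists_separating_ballList hα hU h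
  set D₁ := {R : MeasureSpaceOn X |
    nonnegRat a < (R.toMeasure : Measure X) (closedBallUnionCompl S.pt L₀)} with hD₁
  set D₂ := {R : MeasureSpaceOn X |
    nonnegRat b < (R.toMeasure : Measure X) (ballUnion S.pt (doubleRadii L₀))} with hD₂
  have hK₁ : IsCompact (C \ D₁) := hC.1.diff (hN.measure.isOpen hβ (L₀, a))
  have hK₂ : IsCompact (C \ D₂) := hC.1.diff (hG'.measure.isOpen hβ (L₀, b))
  -- `D₁` and `D₂` cover, so `K₁` and `K₂` are disjoint and `s` separates their members.
  have hlists := exists_ballList_of_separator S hK₁ hK₂ hs hmean fun R hR R' hR' =>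
    hsep R hR.1 R' hR'.1 fun hRR' => (hab R).elim hR.2 (hRR' ▸ hR'.2)
  have hf := computable_two_pow_two_mul_add_two
  -- The separator guarantees that the search for `L k` terminates; the search itself uses only the
  -- enumerable coverings of `C`.
  obtain ⟨L, hL, hCL⟩ := ((hC.rePred_subset hβ (isEffectivelyOpen_thresholds hN hG hf L₀ a)).and
    (hC.rePred_subset hβ (isEffectivelyOpen_thresholds hG' hN' hf L₀ b))).exists_computable
      fun k => by
        obtain ⟨L, h1, h2⟩ := hlists (2 ^ (2 * k + 2))
        exact ⟨L, fun R hR => or_iff_not_imp_left.2 fun hRD => h1 R ⟨hR, hRD⟩,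
          fun R hR => or_iff_not_imp_left.2 fun hRD => h2 R ⟨hR, hRD⟩⟩
  obtain ⟨t₁, ht₁, htop₁⟩ := exists_isUniformTest_of_disjoint S (hN.comp hL) (hG.comp hL)
    fun k => closedBallUnionCompl_subset_compl _ _
  obtain ⟨t₂, ht₂, htop₂⟩ := exists_isUniformTest_of_disjoint S (hG'.comp hL) (hN'.comp hL)
    fun k => Set.subset_compl_comm.1 (closedBallUnionCompl_subset_compl _ _)
  refine Set.eq_empty_of_forall_notMem fun x hx => ?_
  have hfreq : ∃ᶠ k in Filter.atTop, x ∈ closedBallUnionCompl S.pt (L k) ∨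
      x ∈ ballUnion S.pt (doubleRadii (L k)) :=
    (Filter.Eventually.of_forall fun k =>
      mem_closedBallUnionCompl_or_mem_ballUnion S.pt (L k) x).frequently
  rcases Filter.frequently_or_distrib.1 hfreq with hx₁ | hx₂
  · exact (hx.1 t₁ ht₁).ne (htop₁ x P (fun k => ((hCL k).1 hP).resolve_left hPa) hx₁)
  · exact (hx.2 t₂ ht₂).ne (htop₂ x Q (fun k => ((hCL k).2 hQ).resolve_left hQb) hx₂)

end Orthogonality

theorem mainTheorem10 {X : Type*} [MetricSpace X] [MeasurableSpace X] [BorelSpace X]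
    (S : ConstructiveMetricSpace X) (C : Set (MeasureSpaceOn X))
    (hC : IsEffectivelyCompact (measurePt S.pt) C)
    (hs : ∃ s : X × MeasureSpaceOn X → ℝ≥0∞, LowerSemicontinuous s ∧ IsSeparator C s) :
    IsEffectivelyOrthogonal S C := by
  obtain ⟨s, hs, hsC⟩ := hs
  intro P hP Q hQ hPQ
  obtain ⟨U, hU, hne⟩ := exists_isOpen_measure_ne hPQ
  rcases lt_or_gt_of_ne hne with h | h
  · rw [Set.inter_comm]
    exact disjoint_randoms_of_measure_lt S hC hs hsC hQ hP hU h
  · exact disjoint_randoms_of_measure_lt S hC hs hsC hP hQ hU h
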